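/- Let $m,n\ge 1$ be integers. Let $K$ be the convex set of states on $\mathcal B(\mathbb C^m\otimes\mathbb C^n)=\mathcal B(\mathbb C^m)\otimes\mathcal B(\mathbb C^n)$, i.e. of positive linear functionals $\omega$ with $\omega(1)=1$. A state in $K$ is separable if it is a convex combination of product states $\sigma\otimes\tau$, where $\sigma,\tau$ are states on $\mathcal B(\mathbb C^m)$ and $\mathcal B(\mathbb C^n)$ and $(\sigma\otimes\tau)(A\otimes B)=\sigma(A)\tau(B)$; a state that is not separable is entangled. An affine automorphism of $K$ is a bijection $K\to K$ that preserves convex combinations; it preserves entanglement if it maps entangled states to entangled states. Let $(\Phi_t)_{t\in\mathbb R}$ be a one-parameter group of affine automorphisms of $K$, that is, $\Phi_0=\mathrm{id}$ and $\Phi_{s+t}=\Phi_s\circ\Phi_t$ for all $s,t\in\mathbb R$, and suppose that every $\Phi_t$ preserves entanglement. Then there are one-parameter groups of unitaries $(U_t)_{t\in\mathbb R}$ on $\mathbb C^m$ and $(V_t)_{t\in\mathbb R}$ on $\mathbb C^n$ (that is, $U_0=1$, $U_{s+t}=U_sU_t$, and likewise for $V$) such that $$(\Phi_t\omega)(A)=\omega\bigl((U_t\otimes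 V_t)\,A\,(U_t^*\otimes V_t^*)\bigr)\qquad\text{for all } t\in\mathbb R,\ \omega\in K,\ A\in\mathcal B(\mathbb C^m\otimes\mathbb C^n).$$ Moreover, if $t\mapsto(\Phi_t\omega)(A)$ is continuous for all $\omega$ and $A$, then $U_t$ and $V_t$ can be chosen continuous in $t$. -/

import Mathlib

open scoped ComplexOrder Kronecker

namespace SepStates

/-- Linear functionals on the algebra of `ι × ι` complex matrices, that is, on the algebra of
linear operators on `ℂ^ι`. -/
abbrev Functional (ι : Type*) : Type _ := Matrix ι ι ℂ →ₗ[ℂ] ℂ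

/-- The convex set of states on the algebra of linear operators on `ℂ^ι`: the positive linear
functionals taking the value `1` at the identity. -/
def stateSpace (ι : Type*) [Fintype ι] [DecidableEq ι] : Set (Functional ι) :=
  {ω | (∀ A : Matrix ι ι ℂ, A.PosSemidef → 0 ≤ ω A) ∧ ω 1 = 1}

/-- The state space `K` of the operators on `ℂ^m ⊗ ℂ^n`. The space `ℂ^m ⊗ ℂ^n` is `ℂ^(m × n)`
in the product basis, and the operator `A ⊗ B` is the Kronecker product `A ⊗ₖ B`. -/
abbrev K (m n : ℕ) : Set (Functional (Fin m × Fin n)) := stateSpace (Fin m × Fin n)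

/-- `ω` is the product state `σ ⊗ τ` for some states `σ` and `τ`. The operators `A ⊗ B` span all
operators, so the equation determines `ω`. -/
def IsProductState {m n : ℕ} (ω : Functional (Fin m × Fin n)) : Prop :=
  ∃ σ ∈ stateSpace (Fin m), ∃ τ ∈ stateSpace (Fin n),
    ∀ (A : Matrix (Fin m) (Fin m) ℂ) (B : Matrix (Fin n) (Fin n) ℂ), ω (A ⊗ₖ B) = σ A * τ B

/-- The set `S` of separable states: convex combinations of product states. -/
def S (m n : ℕ) : Set (Functional (Fin m × Fin n)) :=
  convexHull ℝ {ω | ω ∈ K m n ∧ IsProductState ω}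

/-- A state is entangled if it is not separable. -/
def IsEntangled {m n : ℕ} (ω : K m n) : Prop := (ω : Functional (Fin m × Fin n)) ∉ S m n

/-- An affine automorphism of a (convex) subset `C` of a real vector space: a bijection of `C`
that preserves convex combinations. -/
structure IsAffineAutomorphism {E : Type*} [AddCommGroup E] [Module ℝ E] {C : Set E}
    (Φ : C → C) : Prop where
  bijective : Function.Bijective Φ
  map_convexCombination : ∀ (x y z : C) (a b : ℝ), 0 ≤ a → 0 ≤ b → a + b = 1 →
    (z : E) = a • (x : E) + b • (y : E) → (Φ z : E) = a • (Φ x : E) + b • (Φ y : E)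

/-- `Φ` takes entangled states to entangled states. -/
def PreservesEntanglement {m n : ℕ} (Φ : K m n → K m n) : Prop :=
  ∀ ω : K m n, IsEntangled ω → IsEntangled (Φ ω)

/-- One-parameter groups of maps `X → X`, in the algebraic sense (no continuity in `t`). -/
structure IsOneParameterGroup {X : Type*} (Φ : ℝ → X → X) : Prop where
  zero : Φ 0 = id
  add : ∀ s t : ℝ, Φ (s + t) = Φ s ∘ Φ t

/-- One-parameter groups of unitaries on `ℂ^k`, in the algebraic sense (no continuity in `t`). -/
structure IsUnitaryOneParameterGroup {k : ℕ} (U : ℝ → Matrix.unitaryGroup (Fin k) ℂ) : Prop where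
  zero : U 0 = 1
  add : ∀ s t : ℝ, U (s + t) = U s * U t

/-- Pointwise continuity of `t ↦ Φ t`: each `t ↦ (Φ t ω)(A)` is continuous. -/
def IsPointwiseContinuous {m n : ℕ} (Φ : ℝ → K m n → K m n) : Prop :=
  ∀ (ω : K m n) (A : Matrix (Fin m × Fin n) (Fin m × Fin n) ℂ),
    Continuous fun t : ℝ => (Φ t ω : Functional (Fin m × Fin n)) A

end SepStates

/-! An affine automorphism extends to a linear map of functionals, hence of density matrices, and it
permutes extreme points, which are the vector states. So it carries each `x xᴴ` to some `u uᴴ`, and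
polarization upgrades this to preservation of rank at most one on all matrices. A bijective linear
map with that property has the form `M ↦ P M Qᵀ`, possibly followed by transposition
(`parallel_dichotomy`, `exists_eq_mul_mul_transpose`). Transposition is the antiunitary alternative
of Wigner's theorem. It disappears on squaring, and every member of a one-parameter group is a
square, so `Φ (t / 2)` is conjugation by a unitary `W`.

The same principle is then used a second time. The inverse `Φ (-t)` preserves entanglement, so `Φ t`
preserves separability. A separable vector state is extreme among the separable states, hence comes
from a product vector (`isRankLEOne_of_vectorState_mem_S`). Vectors of `ℂ^m ⊗ ℂ^n` are `m × n`
matrices, and product vectors are those of rank one, so `W` preserves rank at most one. Now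
transposition is the flip of the tensor factors, and again it disappears on squaring: `W * W = U ⊗ₖ
V`. Two squarings account for `t / 4`.

For each `t` this determines `U` and `V` only up to phases, so they form projective representations
of `ℝ`. Divisibility of `ℝ` together with determinants shows that the unitaries commute
(`commute_of_projective_group`). They therefore have a common eigenvector, and choosing phases that
fix it gives a genuine group. The resulting matrix entries are read off from the conjugation action,
which yields continuity. -/

namespace SepStates

open Matrix

/-! ### Linear maps preserving rank at most one: the row/column alternative. -/

section RankOnePreservers

variable {ι κ ι' κ' : Type*}

/-- All `2 × 2` minors vanish: the matrix has rank at most one. -/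
def IsRankLEOne (M : Matrix ι κ ℂ) : Prop := ∀ i k j l, M i j * M k l = M i l * M k j

/-- Every column of `M` is parallel to every column of `M'`. -/
def ColParallel (M M' : Matrix ι κ ℂ) : Prop := ∀ i k j l, M i j * M' k l = M k j * M' i l

/-- Every row of `M` is parallel to every row of `M'`. -/
def RowParallel (M M' : Matrix ι κ ℂ) : Prop := ∀ i k j l, M i j * M' k l = M i l * M' k j

theorem isRankLEOne_vecMulVec (u : ι → ℂ) (v : κ → ℂ) : IsRankLEOne (vecMulVec u v) := by
  intro i k j l
  simp only [vecMulVec_apply]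
  ring

theorem IsRankLEOne.exists_eq_vecMulVec {M : Matrix ι κ ℂ} (h : IsRankLEOne M) :
    ∃ u v, M = vecMulVec u v := by
  by_cases h0 : ∃ i j, M i j ≠ 0
  · obtain ⟨i, j, hij⟩ := h0
    refine ⟨fun k => M k j / M i j, fun l => M i l, ?_⟩
    ext k l
    rw [vecMulVec_apply, div_mul_eq_mul_div, eq_div_iff hij]
    linear_combination h k i l j
  · push Not at h0
    exact ⟨0, 0, by ext i j; simp [h0, vecMulVec_apply]⟩

theorem exists_apply_ne_zero {M : Matrix ι κ ℂ} (h : M ≠ 0) : ∃ i j, M i j ≠ 0 := by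
  by_contra! h0
  exact h (by ext i j; exact h0 i j)

/-- The `2 × 2` minors of `u vᵀ + u' v'ᵀ` are products of a minor of the pair `u, u'` and a minor of
the pair `v, v'`. If they all vanish, the columns or the rows are parallel. -/
theorem mul_eq_zero_of_isRankLEOne_add {M M' : Matrix ι κ ℂ} (h : IsRankLEOne M)
    (h' : IsRankLEOne M') (hadd : IsRankLEOne (M + M')) (i k : ι) (j l : κ) (i' k' : ι)
    (j' l' : κ) :
    (M i j * M' k l - M k j * M' i l) * (M i' j' * M' k' l' - M i' l' * M' k' j') = 0 := by
  obtain ⟨u, v, rfl⟩ := h.exists_eq_vecMulVec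
  obtain ⟨u', v', rfl⟩ := h'.exists_eq_vecMulVec
  have := hadd i k j' l'
  simp only [vecMulVec_apply, Matrix.add_apply] at this ⊢
  linear_combination v j * v' l * u i' * u' k' * this

/-- If the product of two entire functions vanishes, then one of the factors vanishes. -/
theorem eq_zero_or_eq_zero_of_differentiable {E : Type*} [NormedAddCommGroup E]
    [NormedSpace ℂ E] {f g : E → ℂ} (hf : Differentiable ℂ f) (hg : Differentiable ℂ g)
    (h : ∀ x, f x * g x = 0) : (∀ x, f x = 0) ∨ ∀ x, g x = 0 := by
  by_contra! hne
  obtain ⟨⟨x, hx⟩, y, hy⟩ := hne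
  have hline : Differentiable ℂ fun s : ℂ => x + s • (y - x) := by fun_prop
  have hf' : AnalyticOnNhd ℂ (fun s : ℂ => f (x + s • (y - x))) Set.univ :=
    Complex.analyticOnNhd_univ_iff_differentiable.2 (hf.comp hline)
  have hg' : AnalyticOnNhd ℂ (fun s : ℂ => g (x + s • (y - x))) Set.univ :=
    Complex.analyticOnNhd_univ_iff_differentiable.2 (hg.comp hline)
  rcases AnalyticOnNhd.eq_zero_or_eq_zero_of_mul_eq_zero hf' hg' (fun s _ => h _)
    isPreconnected_univ with h0 | h0
  · exact hx (by simpa using h0 0 trivial)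
  · exact hy (by simpa using h0 1 trivial)

theorem forall_eq_zero_or_forall_eq_zero {E P Q : Type*} [NormedAddCommGroup E]
    [NormedSpace ℂ E] {f : P → E → ℂ} {g : Q → E → ℂ} (hf : ∀ p, Differentiable ℂ (f p))
    (hg : ∀ q, Differentiable ℂ (g q)) (h : ∀ p q x, f p x * g q x = 0) :
    (∀ p x, f p x = 0) ∨ ∀ q x, g q x = 0 := by
  by_contra! hne
  obtain ⟨⟨p, x, hx⟩, q, y, hy⟩ := hne
  rcases eq_zero_or_eq_zero_of_differentiable (hf p) (hg q) (h p q) with h0 | h0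
  · exact hx (h0 x)
  · exact hy (h0 y)

theorem ColParallel.trans {M M' M'' : Matrix ι κ ℂ} (h : ColParallel M M')
    (h' : ColParallel M' M'') (hne : M' ≠ 0) : ColParallel M M'' := by
  obtain ⟨p, q, hpq⟩ := exists_apply_ne_zero hne
  intro i k j l
  apply mul_left_cancel₀ (mul_ne_zero hpq hpq)
  have e1 := h i p j q
  have e2 := h k p j q
  have e3 := h' p k q l
  have e4 := h' p i q l
  linear_combination M' p q * M'' k l * e1 - M' p q * M'' i l * e2 +
    M p j * (M' i q * e3 - M' k q * e4)

theorem vecMulVec_ne_zero_of_ne {x : ι → ℂ} {y : κ → ℂ} (hx : x ≠ 0) (hy : y ≠ 0) :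
    vecMulVec x y ≠ 0 := by
  obtain ⟨i, hi⟩ := Function.ne_iff.1 hx
  obtain ⟨j, hj⟩ := Function.ne_iff.1 hy
  intro h
  have := congrFun (congrFun h i) j
  simp [vecMulVec_apply] at this
  tauto

variable [Fintype ι] [Fintype κ] [DecidableEq ι] [DecidableEq κ]

theorem map_vecMulVec_apply (L : Matrix ι κ ℂ →ₗ[ℂ] Matrix ι' κ' ℂ) (x : ι → ℂ) (y : κ → ℂ)
    (i : ι') (j : κ') :
    L (vecMulVec x y) i j = ∑ k, ∑ l, x k * y l * L (single k l 1) i j := by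
  conv_lhs => rw [matrix_eq_sum_single (vecMulVec x y)]
  simp only [map_sum, Matrix.sum_apply]
  refine Finset.sum_congr rfl fun k _ => Finset.sum_congr rfl fun l _ => ?_
  have : single k l (vecMulVec x y k l) = (x k * y l) • single k l (1 : ℂ) := by
    simp [vecMulVec_apply]
  rw [this, map_smul, Matrix.smul_apply, smul_eq_mul]

theorem differentiable_map_vecMulVec {E : Type*} [NormedAddCommGroup E] [NormedSpace ℂ E]
    (L : Matrix ι κ ℂ →ₗ[ℂ] Matrix ι' κ' ℂ) {a : E → ι → ℂ} {b : E → κ → ℂ}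
    (ha : Differentiable ℂ a) (hb : Differentiable ℂ b) (i : ι') (j : κ') :
    Differentiable ℂ fun e => L (vecMulVec (a e) (b e)) i j := by
  simp only [map_vecMulVec_apply]
  fun_prop

variable {L : Matrix ι κ ℂ →ₗ[ℂ] Matrix ι' κ' ℂ}

/-- The images for `y`, `y'` and `y + y'` all have rank at most one, so for each triple `x, y, y'`
one of the two kinds of parallelism holds. Both are polynomial equations in the triple, and a
product of entire functions vanishes only if a factor does, so the same kind holds for every triple.
-/
theorem colParallel_or_rowParallel_of_fst (h : ∀ x y, IsRankLEOne (L (vecMulVec x y))) :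
    (∀ x y y', ColParallel (L (vecMulVec x y)) (L (vecMulVec x y'))) ∨
      ∀ x y y', RowParallel (L (vecMulVec x y)) (L (vecMulVec x y')) := by
  have key := forall_eq_zero_or_forall_eq_zero (E := (ι → ℂ) × (κ → ℂ) × (κ → ℂ))
    (P := ι' × ι' × κ' × κ') (Q := ι' × ι' × κ' × κ')
    (f := fun p e => L (vecMulVec e.1 e.2.1) p.1 p.2.2.1 * L (vecMulVec e.1 e.2.2) p.2.1 p.2.2.2 -
      L (vecMulVec e.1 e.2.1) p.2.1 p.2.2.1 * L (vecMulVec e.1 e.2.2) p.1 p.2.2.2)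
    (g := fun p e => L (vecMulVec e.1 e.2.1) p.1 p.2.2.1 * L (vecMulVec e.1 e.2.2) p.2.1 p.2.2.2 -
      L (vecMulVec e.1 e.2.1) p.1 p.2.2.2 * L (vecMulVec e.1 e.2.2) p.2.1 p.2.2.1)
    (fun p => by
      refine Differentiable.sub (Differentiable.mul ?_ ?_) (Differentiable.mul ?_ ?_) <;>
      exact differentiable_map_vecMulVec L (by fun_prop) (by fun_prop) _ _)
    (fun p => by
      refine Differentiable.sub (Differentiable.mul ?_ ?_) (Differentiable.mul ?_ ?_) <;>
      exact differentiable_map_vecMulVec L (by fun_prop) (by fun_prop) _ _)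
    (fun p q e => mul_eq_zero_of_isRankLEOne_add (h _ _) (h _ _)
      (by rw [← map_add, ← vecMulVec_add]; exact h _ _) _ _ _ _ _ _ _ _)
  refine key.imp (fun hk x y y' i k j l => ?_) (fun hk x y y' i k j l => ?_)
  · exact sub_eq_zero.1 (hk (i, k, j, l) (x, y, y'))
  · exact sub_eq_zero.1 (hk (i, k, j, l) (x, y, y'))

theorem colParallel_or_rowParallel_of_snd (h : ∀ x y, IsRankLEOne (L (vecMulVec x y))) :
    (∀ x x' y, ColParallel (L (vecMulVec x y)) (L (vecMulVec x' y))) ∨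
      ∀ x x' y, RowParallel (L (vecMulVec x y)) (L (vecMulVec x' y)) := by
  have := colParallel_or_rowParallel_of_fst
    (L := L ∘ₗ (transposeLinearEquiv κ ι ℂ ℂ).toLinearMap) (fun y x => by
      simpa [transpose_vecMulVec] using h x y)
  refine this.imp (fun hk x x' y => ?_) (fun hk x x' y => ?_)
  · simpa [transpose_vecMulVec] using hk y x x'
  · simpa [transpose_vecMulVec] using hk y x x'

end RankOnePreservers

/-! ### Linear maps preserving rank at most one: their explicit form. -/

section RankOnePreservers

theorem single_eq_vecMulVec {ι κ : Type*} [DecidableEq ι] [DecidableEq κ] (i : ι) (j : κ)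
    (c : ℂ) : single i j c = vecMulVec (Pi.single i c) (Pi.single j 1) := by
  ext p q
  rcases eq_or_ne i p with rfl | hp <;> rcases eq_or_ne j q with rfl | hq <;>
    simp [vecMulVec_apply, *]

variable {ι κ ι' κ' : Type*} [Fintype ι] [Fintype κ] [DecidableEq ι] [DecidableEq κ]

theorem colParallel_map {L : Matrix ι κ ℂ →ₗ[ℂ] Matrix ι' κ' ℂ}
    (hL : Function.Injective L)
    (h₁ : ∀ x y y', ColParallel (L (vecMulVec x y)) (L (vecMulVec x y')))
    (h₂ : ∀ x x' y, ColParallel (L (vecMulVec x y)) (L (vecMulVec x' y)))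
    (M M' : Matrix ι κ ℂ) : ColParallel (L M) (L M') := by
  have hvec : ∀ x y x' y', ColParallel (L (vecMulVec x y)) (L (vecMulVec x' y')) := by
    intro x y x' y'
    by_cases hx : x = 0
    · intro i k j l; simp [hx]
    by_cases hy : y' = 0
    · have h0 : L (vecMulVec x' y') = 0 := by
        rw [hy]
        convert map_zero L
        ext
        simp [vecMulVec_apply]
      intro i k j l
      simp [h0]
    refine (h₁ x y y').trans (h₂ x x' y') fun h => vecMulVec_ne_zero_of_ne hx hy ?_
    exact hL (by rw [h, map_zero])
  have hleft : ∀ x y, ColParallel (L M) (L (vecMulVec x y)) := by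
    intro x y
    induction M using Matrix.induction_on' with
    | h_zero => intro i k j l; simp
    | h_add A B hA hB =>
      intro i k j l
      simp only [map_add, Matrix.add_apply]
      linear_combination hA i k j l + hB i k j l
    | h_std_basis i j c => rw [single_eq_vecMulVec]; exact hvec _ _ _ _
  induction M' using Matrix.induction_on' with
  | h_zero => intro i k j l; simp
  | h_add A B hA hB =>
    intro i k j l
    simp only [map_add, Matrix.add_apply]
    linear_combination hA i k j l + hB i k j l
  | h_std_basis i j c => rw [single_eq_vecMulVec]; exact hleft _ _

theorem rowParallel_map {L : Matrix ι κ ℂ →ₗ[ℂ] Matrix ι' κ' ℂ}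
    (hL : Function.Injective L)
    (h₁ : ∀ x y y', RowParallel (L (vecMulVec x y)) (L (vecMulVec x y')))
    (h₂ : ∀ x x' y, RowParallel (L (vecMulVec x y)) (L (vecMulVec x' y)))
    (M M' : Matrix ι κ ℂ) : RowParallel (L M) (L M') := by
  have := colParallel_map
    (L := (transposeLinearEquiv ι' κ' ℂ ℂ).toLinearMap ∘ₗ L)
    ((transposeLinearEquiv ι' κ' ℂ ℂ).injective.comp hL)
    (fun x y y' i k j l => h₁ x y y' j l i k) (fun x x' y i k j l => h₂ x x' y j l i k) M M'
  exact fun i k j l => this j l i k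

/-- If both variables gave the same kind of parallelism, surjectivity would make all matrices
parallel in that sense. This is possible only when one index type has at most one element, and then
the mixed alternative holds as well. -/
theorem parallel_dichotomy {L : Matrix ι κ ℂ →ₗ[ℂ] Matrix ι κ ℂ}
    (hL : Function.Bijective L) (h : ∀ x y, IsRankLEOne (L (vecMulVec x y))) :
    ((∀ x y y', ColParallel (L (vecMulVec x y)) (L (vecMulVec x y'))) ∧
      ∀ x x' y, RowParallel (L (vecMulVec x y)) (L (vecMulVec x' y))) ∨
    ((∀ x y y', RowParallel (L (vecMulVec x y)) (L (vecMulVec x y'))) ∧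
      ∀ x x' y, ColParallel (L (vecMulVec x y)) (L (vecMulVec x' y))) := by
  rcases colParallel_or_rowParallel_of_fst h with h₁ | h₁ <;>
    rcases colParallel_or_rowParallel_of_snd h with h₂ | h₂
  · left
    refine ⟨h₁, fun x x' y i k j l => ?_⟩
    have hall : ∀ M M' : Matrix ι κ ℂ, ColParallel M M' := fun M M' => by
      obtain ⟨A, rfl⟩ := hL.2 M
      obtain ⟨B, rfl⟩ := hL.2 M'
      exact colParallel_map hL.1 h₁ h₂ A B
    have hsub : ∀ p q : ι, p = q := by
      intro p q
      by_contra hpq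
      have := hall (single p j 1) (single q j 1) p q j j
      simp [hpq] at this
    -- With a single row index, vectors are scalars, so the two images are multiples of one matrix
    -- of rank at most one.
    have hscal : ∀ z : ι → ℂ, z = z i • (1 : ι → ℂ) := fun z => by
      ext p; simp [hsub p i]
    have := h 1 y i k j l
    rw [hscal x, hscal x']
    simp only [smul_vecMulVec, map_smul, Matrix.smul_apply, smul_eq_mul]
    linear_combination x i * x' i * this
  · exact Or.inl ⟨h₁, h₂⟩
  · exact Or.inr ⟨h₁, h₂⟩
  · left
    have hall : ∀ M M' : Matrix ι κ ℂ, RowParallel M M' := fun M M' => by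
      obtain ⟨A, rfl⟩ := hL.2 M
      obtain ⟨B, rfl⟩ := hL.2 M'
      exact rowParallel_map hL.1 h₁ h₂ A B
    refine ⟨fun x y y' i k j l => ?_, h₂⟩
    have hsub : ∀ p q : κ, p = q := by
      intro p q
      by_contra hpq
      have := hall (single i p 1) (single i q 1) i i p q
      simp [hpq] at this
    have hscal : ∀ z : κ → ℂ, z = z j • (1 : κ → ℂ) := fun z => by
      ext p; simp [hsub p j]
    have := h x 1 i k j l
    rw [hsub l j, hscal y, hscal y'] at *
    simp only [vecMulVec_smul, map_smul, Matrix.smul_apply, smul_eq_mul]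
    ring

theorem exists_eq_smul_of_forall_vecMulVec {H : Matrix ι κ ℂ →ₗ[ℂ] Matrix ι κ ℂ}
    (h : ∀ x y, ∃ c : ℂ, H (vecMulVec x y) = c • vecMulVec x y) :
    ∃ c : ℂ, ∀ M, H M = c • M := by
  have hs : ∀ i j, ∃ c : ℂ, H (single i j 1) = c • single i j 1 := by
    intro i j
    obtain ⟨c, hc⟩ := h (Pi.single i 1) (Pi.single j 1)
    exact ⟨c, by rwa [← single_eq_single_vecMulVec_single] at hc⟩
  choose d hd using hs
  -- `H` multiplies matrices entrywise by `d`. The all-ones matrix, itself of rank one, forces `d`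
  -- to be constant.
  obtain ⟨c, hc⟩ := h 1 1
  have hexp : ∀ M : Matrix ι κ ℂ, H M = of fun i j => M i j * d i j := by
    intro M
    induction M using Matrix.induction_on' with
    | h_zero => rw [map_zero]; ext; simp
    | h_add A B hA hB => rw [map_add, hA, hB]; ext; simp [add_mul]
    | h_std_basis i j a =>
      have : single i j a = a • single i j (1 : ℂ) := by simp
      rw [this, map_smul, hd]
      ext p q
      by_cases hpq : i = p ∧ j = q
      · obtain ⟨rfl, rfl⟩ := hpq
        simp
      · simp [single_apply_of_ne _ _ _ _ _ hpq]
  refine ⟨c, fun M => ?_⟩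
  have hcd : ∀ i j, d i j = c := fun i j => by
    have := congrFun (congrFun hc i) j
    simpa [hexp, vecMulVec_apply] using this
  rw [hexp]
  ext i j
  simp [hcd, mul_comm]

variable [Fintype ι'] [Fintype κ']

theorem exists_eq_mul_mul_transpose {L : Matrix ι κ ℂ →ₗ[ℂ] Matrix ι' κ' ℂ}
    (hL : Function.Bijective L)
    (h₁ : ∀ x y y', ColParallel (L (vecMulVec x y)) (L (vecMulVec x y')))
    (h₂ : ∀ x x' y, RowParallel (L (vecMulVec x y)) (L (vecMulVec x' y))) :
    ∃ (P : Matrix ι' ι ℂ) (Q : Matrix κ' κ ℂ), ∀ M, L M = P * M * Qᵀ := by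
  by_cases hM : ∀ M : Matrix ι κ ℂ, M = 0
  · exact ⟨0, 0, fun M => by rw [hM M]; simp⟩
  have hne : vecMulVec (1 : ι → ℂ) (1 : κ → ℂ) ≠ 0 := by
    push Not at hM
    obtain ⟨M, hM⟩ := hM
    obtain ⟨i, j, -⟩ := exists_apply_ne_zero hM
    intro h0
    simpa [vecMulVec_apply] using congrFun (congrFun h0 i) j
  obtain ⟨x₀, y₀, hne⟩ : ∃ x y, vecMulVec (x : ι → ℂ) (y : κ → ℂ) ≠ 0 := ⟨1, 1, hne⟩
  obtain ⟨k, l, hkl⟩ : ∃ k l, L (vecMulVec x₀ y₀) k l ≠ 0 :=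
    exists_apply_ne_zero fun h0 => hne (hL.1 (by rw [h0, map_zero]))
  -- `P` records the column direction (column `l` with `y₀` fixed) and `Q` the row direction (row
  -- `k` with `x₀` fixed). By parallelism `P * x yᵀ * Qᵀ` is a multiple of `L (x yᵀ)`, so `L⁻¹ ∘ G`
  -- is scalar on each rank-one matrix, hence scalar.
  let p : (ι → ℂ) →ₗ[ℂ] (ι' → ℂ) :=
    { toFun := fun x i => L (vecMulVec x y₀) i l
      map_add' := fun x y => by ext; simp [add_vecMulVec]
      map_smul' := fun c x => by ext; simp [smul_vecMulVec] }
  let q : (κ → ℂ) →ₗ[ℂ] (κ' → ℂ) :=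
    { toFun := fun y j => L (vecMulVec x₀ y) k j
      map_add' := fun x y => by ext; simp [vecMulVec_add]
      map_smul' := fun c x => by ext; simp [vecMulVec_smul] }
  let P := LinearMap.toMatrix' p
  let Q := LinearMap.toMatrix' q
  have hPQ : ∀ x y i j, (P * vecMulVec x y * Qᵀ) i j =
      L (vecMulVec x y₀) i l * L (vecMulVec x₀ y) k j := by
    intro x y i j
    rw [mul_vecMulVec, vecMulVec_mul, vecMul_transpose, vecMulVec_apply]
    simp only [P, Q, LinearMap.toMatrix'_mulVec]
    rfl
  let G : Matrix ι κ ℂ →ₗ[ℂ] Matrix ι' κ' ℂ :=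
    { toFun := fun M => P * M * Qᵀ
      map_add' := fun A B => by rw [Matrix.mul_add, Matrix.add_mul]
      map_smul' := fun c A => by simp }
  let e := LinearEquiv.ofBijective L hL
  obtain ⟨c, hc⟩ : ∃ c : ℂ, ∀ M, (e.symm.toLinearMap ∘ₗ G) M = c • M := by
    refine exists_eq_smul_of_forall_vecMulVec fun x y => ?_
    by_cases h0 : L (vecMulVec x y) = 0
    · have : vecMulVec x y = 0 := hL.1 (by rw [h0, map_zero])
      exact ⟨0, by simp [this]⟩
    obtain ⟨r, s, hrs⟩ := exists_apply_ne_zero h0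
    refine ⟨L (vecMulVec x y₀) r l * L (vecMulVec x₀ y) k s / L (vecMulVec x y) r s, ?_⟩
    apply e.injective
    rw [map_smul]
    simp only [LinearMap.comp_apply, LinearEquiv.coe_coe, LinearEquiv.apply_symm_apply]
    ext i j
    refine (hPQ x y i j).trans ?_
    change _ = _ * L (vecMulVec x y) i j
    rw [div_mul_eq_mul_div, eq_div_iff hrs]
    linear_combination L (vecMulVec x₀ y) k j * h₁ x y y₀ r i s l +
      L (vecMulVec x y₀) r l * h₂ x x₀ y i k s j
  have hG : ∀ M, P * M * Qᵀ = c • L M := fun M => by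
    have := congrArg e (hc M)
    simpa [G, e] using this
  have hc0 : c ≠ 0 := by
    rintro rfl
    have := congrFun (congrFun (hG (vecMulVec x₀ y₀)) k) l
    rw [hPQ] at this
    simp [hkl] at this
  exact ⟨c⁻¹ • P, Q, fun M => by
    rw [smul_mul, smul_mul, hG, smul_smul, inv_mul_cancel₀ hc0, one_smul]⟩

/-- The square of a linear automorphism of a matrix space which preserves matrices of rank at most
one is of the form `M ↦ P * M * Qᵀ`. -/
theorem exists_sq_eq_mul_mul_transpose {L : Matrix ι κ ℂ →ₗ[ℂ] Matrix ι κ ℂ}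
    (hL : Function.Bijective L) (h : ∀ x y, IsRankLEOne (L (vecMulVec x y))) :
    ∃ (P : Matrix ι ι ℂ) (Q : Matrix κ κ ℂ), ∀ M, L (L M) = P * M * Qᵀ := by
  rcases parallel_dichotomy hL h with ⟨h₁, h₂⟩ | ⟨h₁, h₂⟩
  · obtain ⟨P, Q, hPQ⟩ := exists_eq_mul_mul_transpose hL h₁ h₂
    exact ⟨P * P, Q * Q, fun M => by simp only [hPQ, transpose_mul, Matrix.mul_assoc]⟩
  -- In the other alternative the transpose of `L` has the standard form, so `L M = Q * Mᵀ * Pᵀ`,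
  -- and the two transpositions in `L (L M)` cancel.
  · obtain ⟨P, Q, hPQ⟩ := exists_eq_mul_mul_transpose
      (L := (transposeLinearEquiv ι κ ℂ ℂ).toLinearMap ∘ₗ L)
      ((transposeLinearEquiv ι κ ℂ ℂ).bijective.comp hL)
      (fun x y y' i k j l => h₁ x y y' j l i k) (fun x x' y i k j l => h₂ x x' y j l i k)
    have hPQ' : ∀ M, L M = Q * Mᵀ * Pᵀ := fun M => by
      have := congrArg transpose (hPQ M)
      simpa [transpose_mul, Matrix.mul_assoc] using this
    exact ⟨Q * P, P * Q, fun M => by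
      simp only [hPQ', transpose_mul, transpose_transpose, Matrix.mul_assoc]⟩

end RankOnePreservers

/-! ### Polarization from `x xᴴ` to all rank-one matrices. -/

section Polarization

variable {ι ι' κ' : Type*}

theorem map_vecMulVec_add_smul {V : Type*} [AddCommGroup V] [Module ℂ V]
    (L : Matrix ι ι ℂ →ₗ[ℂ] V) (x y : ι → ℂ) (z : ℂ) :
    L (vecMulVec (x + z • y) (star (x + z • y))) =
      L (vecMulVec x (star x)) + z • L (vecMulVec y (star x)) +
        star z • L (vecMulVec x (star y)) + (z * star z) • L (vecMulVec y (star y)) := by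
  simp only [← map_smul, ← map_add]
  congr 1
  ext i j
  simp [vecMulVec_apply]
  ring

theorem four_smul_map_vecMulVec {V : Type*} [AddCommGroup V] [Module ℂ V]
    (L : Matrix ι ι ℂ →ₗ[ℂ] V) (x y : ι → ℂ) :
    (4 : ℂ) • L (vecMulVec x (star y)) =
      L (vecMulVec (x + (1 : ℂ) • y) (star (x + (1 : ℂ) • y))) -
      L (vecMulVec (x + (-1 : ℂ) • y) (star (x + (-1 : ℂ) • y))) +
      Complex.I • L (vecMulVec (x + Complex.I • y) (star (x + Complex.I • y))) -
      Complex.I • L (vecMulVec (x + (-Complex.I) • y) (star (x + (-Complex.I) • y))) := by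
  simp only [map_vecMulVec_add_smul]
  simp only [star_one, star_neg, Complex.star_def, Complex.conj_I]
  match_scalars <;>
    first
    | ring1
    | linear_combination 2 * Complex.I_sq
    | linear_combination -2 * Complex.I_sq

/-- Each minor of the image of `v vᴴ` with `v = star y + z • x` is a polynomial in `z` and its
conjugate that vanishes for every `z`. Its `z²` coefficient is the corresponding minor of `L (x
yᵀ)`. -/
theorem isRankLEOne_map_of_isRankLEOne_map_self {L : Matrix ι ι ℂ →ₗ[ℂ] Matrix ι' κ' ℂ}
    (h : ∀ x, IsRankLEOne (L (vecMulVec x (star x)))) (x y : ι → ℂ) :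
    IsRankLEOne (L (vecMulVec x y)) := by
  intro i k j l
  set a := L (vecMulVec (star y) (star (star y))) with ha
  set b := L (vecMulVec x (star (star y))) with hb
  set c := L (vecMulVec (star y) (star x)) with hc
  set d := L (vecMulVec x (star x)) with hd
  let m (M M' : Matrix ι' κ' ℂ) : ℂ := M i j * M' k l - M i l * M' k j
  -- Here `w` is the conjugate of `z`, and `p`, `q`, `n` are `z²`, `w²`, `|z|²`. The fourth roots of
  -- unity isolate `m b b + m c c`, and the points `±1 ± I` isolate `m b b - m c c`.
  have key : ∀ z w p q n : ℂ, star z = w → z * z = p → w * w = q → z * w = n →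
      m a a + z * (m a b + m b a) + w * (m a c + m c a) + p * m b b + q * m c c +
        n * (m a d + m d a + m b c + m c b) + n * z * (m b d + m d b) +
        n * w * (m c d + m d c) + n * n * m d d = 0 := by
    rintro z _ _ _ _ rfl rfl rfl rfl
    have := h (star y + z • x) i k j l
    simp only [map_vecMulVec_add_smul, Matrix.add_apply, Matrix.smul_apply, smul_eq_mul] at this
    simp only [m]
    linear_combination this
  have hI := Complex.I_mul_I
  have h1 := key 1 1 1 1 1 (by simp) (by ring) (by ring) (by ring)
  have h2 := key Complex.I (-Complex.I) (-1) (-1) 1 (by simp) (by simp) (by simp) (by simp)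
  have h3 := key (-1) (-1) 1 1 1 (by simp) (by ring) (by ring) (by ring)
  have h4 := key (-Complex.I) Complex.I (-1) (-1) 1 (by simp) (by simp) (by simp) (by simp)
  have h5 := key (1 + Complex.I) (1 - Complex.I) (2 * Complex.I) (-2 * Complex.I) 2
    (by simp [sub_eq_add_neg]) (by linear_combination hI) (by linear_combination hI)
    (by linear_combination -hI)
  have h6 := key (-1 + Complex.I) (-1 - Complex.I) (-2 * Complex.I) (2 * Complex.I) 2
    (by simp [sub_eq_add_neg]) (by linear_combination hI) (by linear_combination hI)
    (by linear_combination -hI)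
  have h7 := key (-1 - Complex.I) (-1 + Complex.I) (2 * Complex.I) (-2 * Complex.I) 2
    (by simp [sub_eq_add_neg]) (by linear_combination hI) (by linear_combination hI)
    (by linear_combination -hI)
  have h8 := key (1 - Complex.I) (1 + Complex.I) (-2 * Complex.I) (2 * Complex.I) 2
    (by simp [sub_eq_add_neg]) (by linear_combination hI) (by linear_combination hI)
    (by linear_combination -hI)
  have hbb : m b b = 0 := by
    linear_combination (1 / 8) * (h1 - h2 + h3 - h4) - Complex.I / 16 * (h5 - h6 + h7 - h8) +
      (m b b - m c c) / 2 * hI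
  simp only [m, hb, star_star] at hbb
  exact sub_eq_zero.1 hbb

theorem linearMap_ext_of_vecMulVec_self [Fintype ι] [DecidableEq ι] {V : Type*}
    [AddCommGroup V] [Module ℂ V]
    {L L' : Matrix ι ι ℂ →ₗ[ℂ] V}
    (h : ∀ x, L (vecMulVec x (star x)) = L' (vecMulVec x (star x))) : L = L' := by
  ext M
  induction M using Matrix.induction_on' with
  | h_zero => simp
  | h_add A B hA hB => rw [map_add, map_add, hA, hB]
  | h_std_basis i j c =>
    rw [single_eq_vecMulVec, ← star_star (Pi.single j 1 : ι → ℂ)]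
    have h4 : (4 : ℂ) ≠ 0 := by norm_num
    apply (smul_right_injective V h4)
    simp only [four_smul_map_vecMulVec, h]

end Polarization

/-! ### Extracting unitaries from scalar multiples and Kronecker factors. -/

section Unitary

variable {ι κ : Type*} [Fintype ι] [Fintype κ] [DecidableEq ι] [DecidableEq κ]

theorem exists_unitary_of_conjTranspose_mul_self_eq_smul [Nonempty ι] {A : Matrix ι ι ℂ} {c : ℂ}
    (hc : c ≠ 0) (h : Aᴴ * A = c • 1) :
    ∃ r : ℝ, 0 < r ∧ c = r * r ∧ ∃ U ∈ unitaryGroup ι ℂ, A = (r : ℂ) • U := by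
  obtain ⟨i⟩ := ‹Nonempty ι›
  have h0 : 0 ≤ c := by
    have := (posSemidef_conjTranspose_mul_self A).diag_nonneg (i := i)
    rw [h] at this
    simpa using this
  obtain ⟨s, rfl⟩ : ∃ s : ℝ, c = s := ⟨c.re, Complex.eq_re_of_ofReal_le h0⟩
  have hs : 0 < s := lt_of_le_of_ne (by exact_mod_cast h0) (by rintro rfl; simp at hc)
  have hr : (0 : ℝ) < √s := Real.sqrt_pos.2 hs
  have hr' : ((√s : ℝ) : ℂ) ≠ 0 := by exact_mod_cast hr.ne'
  have hsq : (s : ℂ) = (√s : ℝ) * (√s : ℝ) := by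
    rw [← Complex.ofReal_mul, Real.mul_self_sqrt hs.le]
  refine ⟨√s, hr, hsq, ((√s : ℝ) : ℂ)⁻¹ • A, ?_, by rw [smul_inv_smul₀ hr']⟩
  rw [mem_unitaryGroup_iff', star_eq_conjTranspose, conjTranspose_smul, smul_mul, Matrix.mul_smul,
    h, smul_smul, smul_smul, hsq]
  simp only [star_inv₀, Complex.star_def, Complex.conj_ofReal]
  rw [show ((√s : ℝ) : ℂ)⁻¹ * ((√s : ℝ) : ℂ)⁻¹ * ((√s : ℝ) * (√s : ℝ)) = 1 by field_simp, one_smul]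

/-- Since `(Pᴴ * P) ⊗ₖ (Qᴴ * Q) = 1`, the factor `Pᴴ * P` is scalar. Moving a positive scalar from
`P` to `Q` makes both unitary. -/
theorem exists_unitary_kronecker_eq [Nonempty ι] [Nonempty κ] {P : Matrix ι ι ℂ}
    {Q : Matrix κ κ ℂ} (h : P ⊗ₖ Q ∈ unitaryGroup (ι × κ) ℂ) :
    ∃ U ∈ unitaryGroup ι ℂ, ∃ V ∈ unitaryGroup κ ℂ, P ⊗ₖ Q = U ⊗ₖ V := by
  have hent : ∀ {A : Matrix ι ι ℂ} {B : Matrix κ κ ℂ}, A ⊗ₖ B ∈ unitaryGroup (ι × κ) ℂ →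
      (Aᴴ * A) ⊗ₖ (Bᴴ * B) = 1 := fun {A B} hAB => by
    rw [mem_unitaryGroup_iff', star_eq_conjTranspose, conjTranspose_kronecker,
      ← mul_kronecker_mul] at hAB
    exact hAB
  have h1 := hent h
  obtain ⟨j⟩ := ‹Nonempty κ›
  have hone : ∀ i k, (Pᴴ * P) i k * (Qᴴ * Q) j j = (1 : Matrix ι ι ℂ) i k := fun i k => by
    have := congrFun (congrFun h1 (i, j)) (k, j)
    rw [kroneckerMap_apply] at this
    rw [this]
    simp [Matrix.one_apply]
  have hb : (Qᴴ * Q) j j ≠ 0 := fun hb => by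
    obtain ⟨i⟩ := ‹Nonempty ι›
    simpa [hb] using hone i i
  obtain ⟨r, hr, -, U, hU, hPU⟩ := exists_unitary_of_conjTranspose_mul_self_eq_smul (A := P)
    (inv_ne_zero hb) (by
      ext i k
      rw [Matrix.smul_apply, ← hone, smul_eq_mul]
      field_simp)
  have hUV : P ⊗ₖ Q = U ⊗ₖ ((r : ℂ) • Q) := by
    rw [hPU, smul_kronecker, kronecker_smul]
  refine ⟨U, hU, (r : ℂ) • Q, ?_, hUV⟩
  rw [hUV] at h
  have h2 := hent h
  rw [mem_unitaryGroup_iff', star_eq_conjTranspose] at hU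
  rw [mem_unitaryGroup_iff', star_eq_conjTranspose]
  rw [hU] at h2
  obtain ⟨i⟩ := ‹Nonempty ι›
  ext k l
  simpa [Matrix.one_apply] using congrFun (congrFun h2 (i, k)) (i, l)

/-- Trace preservation gives `R * P = 1`. Compatibility with adjoints gives `P * M * R = Rᴴ * M *
Pᴴ`, which makes `P` proportional to `Rᴴ`; a rescaling then produces the unitary. -/
theorem exists_unitary_of_map_eq_mul_mul [Nonempty ι] {L : Matrix ι ι ℂ →ₗ[ℂ] Matrix ι ι ℂ}
    {P R : Matrix ι ι ℂ} (hPR : ∀ M, L M = P * M * R)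
    (hL : ∀ x, ∃ u, L (vecMulVec x (star x)) = vecMulVec u (star u))
    (htr : ∀ M, (L M).trace = M.trace) :
    ∃ W ∈ unitaryGroup ι ℂ, ∀ M, L M = W * M * Wᴴ := by
  have hRP : R * P = 1 := by
    refine Matrix.ext_iff_trace_mul_right.2 fun M => ?_
    rw [Matrix.one_mul, ← htr M, hPR, Matrix.mul_assoc, trace_mul_comm]
  let L' : Matrix ι ι ℂ →ₗ[ℂ] Matrix ι ι ℂ :=
    { toFun := fun M => (L Mᴴ)ᴴ
      map_add' := by simp
      map_smul' := by simp }
  have hLL : L = L' := linearMap_ext_of_vecMulVec_self fun x => by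
    obtain ⟨u, hu⟩ := hL x
    change _ = (L _ᴴ)ᴴ
    simp [conjTranspose_vecMulVec, hu]
  have hadj : ∀ M, P * M * R = Rᴴ * M * Pᴴ := fun M => by
    rw [← hPR M, hLL]
    change (L Mᴴ)ᴴ = _
    simp [hPR, Matrix.mul_assoc]
  have hent : ∀ i k l j, P i k * R l j = star (R k i) * star (P j l) := fun i k l j => by
    have := congrFun (congrFun (hadj (vecMulVec (Pi.single k 1) (Pi.single l 1))) i) j
    simpa [mul_vecMulVec, vecMulVec_mul, vecMulVec_apply] using this
  have hR : R ≠ 0 := by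
    rintro rfl
    simp at hRP
  obtain ⟨l, j, hlj⟩ := exists_apply_ne_zero hR
  set c := star (P j l) / R l j with hc
  have hP : P = c • Rᴴ := by
    ext i k
    rw [Matrix.smul_apply, conjTranspose_apply, smul_eq_mul, hc, div_mul_eq_mul_div,
      eq_div_iff hlj, hent, mul_comm]
  have hc0 : c ≠ 0 := by
    intro h0
    rw [hP, h0] at hRP
    simp at hRP
  obtain ⟨r, hr, hcr, U, hU, hRU⟩ := exists_unitary_of_conjTranspose_mul_self_eq_smul (A := Rᴴ)
    (inv_ne_zero hc0) (by
      rw [conjTranspose_conjTranspose, eq_inv_smul_iff₀ hc0, ← Matrix.mul_smul, ← hP, hRP])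
  refine ⟨U, hU, fun M => ?_⟩
  have hR' : R = (r : ℂ) • Uᴴ := by
    rw [← conjTranspose_conjTranspose R, hRU]
    simp
  rw [hPR, hP, hRU, hR']
  simp only [smul_mul, Matrix.mul_smul, smul_smul]
  rw [show (r : ℂ) * (c * r) = c * (r * r) by ring, ← hcr, mul_inv_cancel₀ hc0, one_smul]

end Unitary

/-! ### Density matrices and the extreme points of the state space. -/

section States

variable {ι : Type*} [Fintype ι]

/-- The functional `A ↦ ⟨x, A x⟩`. -/
def vectorState (x : ι → ℂ) : Functional ι where
  toFun A := star x ⬝ᵥ A *ᵥ x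
  map_add' A B := by rw [add_mulVec, dotProduct_add]
  map_smul' c A := by rw [smul_mulVec, dotProduct_smul, RingHom.id_apply]

theorem vectorState_apply (x : ι → ℂ) (A : Matrix ι ι ℂ) :
    vectorState x A = star x ⬝ᵥ A *ᵥ x := rfl

theorem trace_vecMulVec_mul (x y : ι → ℂ) (A : Matrix ι ι ℂ) :
    (vecMulVec x y * A).trace = y ⬝ᵥ A *ᵥ x := by
  rw [trace_mul_comm, mul_vecMulVec, trace_vecMulVec, dotProduct_comm]

theorem exists_smul_unit {x : ι → ℂ} (hx : x ≠ 0) :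
    ∃ (r : ℝ) (u : ι → ℂ), 0 < r ∧ star u ⬝ᵥ u = 1 ∧ x = (r : ℂ) • u := by
  have h0 : 0 ≤ star x ⬝ᵥ x := dotProduct_star_self_nonneg x
  have h1 : star x ⬝ᵥ x ≠ 0 := fun h => hx (dotProduct_star_self_eq_zero.1 h)
  obtain ⟨s, hs⟩ : ∃ s : ℝ, star x ⬝ᵥ x = s := ⟨_, Complex.eq_re_of_ofReal_le h0⟩
  rw [hs] at h0 h1
  have hs0 : 0 < s := lt_of_le_of_ne (by exact_mod_cast h0) (by rintro rfl; simp at h1)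
  have hr : (0 : ℝ) < √s := Real.sqrt_pos.2 hs0
  have hr' : ((√s : ℝ) : ℂ) ≠ 0 := by exact_mod_cast hr.ne'
  have hsq : (s : ℂ) = (√s : ℝ) * (√s : ℝ) := by
    rw [← Complex.ofReal_mul, Real.mul_self_sqrt hs0.le]
  refine ⟨√s, ((√s : ℝ) : ℂ)⁻¹ • x, hr, ?_, (smul_inv_smul₀ hr' x).symm⟩
  rw [star_smul, smul_dotProduct, dotProduct_smul, hs, hsq]
  simp only [star_inv₀, Complex.star_def, Complex.conj_ofReal, smul_eq_mul]
  field_simp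

theorem vectorState_smul (c : ℂ) (x : ι → ℂ) :
    vectorState (c • x) = (star c * c) • vectorState x := by
  refine LinearMap.ext fun A => ?_
  simp only [vectorState_apply, star_smul, mulVec_smul, smul_dotProduct, dotProduct_smul,
    LinearMap.smul_apply, smul_smul, mul_comm]

theorem vectorState_zero : vectorState (0 : ι → ℂ) = 0 :=
  LinearMap.ext fun A => by simp [vectorState_apply]

theorem mul_vecMulVec_self_mul (W : Matrix ι ι ℂ) (x : ι → ℂ) :
    W * vecMulVec x (star x) * Wᴴ = vecMulVec (W *ᵥ x) (star (W *ᵥ x)) := by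
  rw [mul_vecMulVec, vecMulVec_mul, star_mulVec]

variable [DecidableEq ι]

/-- The density matrix of a functional. -/
def density : Functional ι ≃ₗ[ℂ] Matrix ι ι ℂ where
  toFun ω := of fun i j => ω (single j i 1)
  map_add' ω ω' := by ext; simp
  map_smul' c ω := by ext; simp
  invFun M :=
    { toFun := fun A => (M * A).trace
      map_add' := by simp [Matrix.mul_add]
      map_smul' := by simp }
  left_inv ω := by
    refine LinearMap.ext fun A => ?_
    simp only [LinearMap.coe_mk, AddHom.coe_mk]
    conv_rhs => rw [matrix_eq_sum_single A]
    simp only [map_sum, trace, diag_apply, Matrix.mul_apply, of_apply]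
    rw [Finset.sum_comm]
    refine Finset.sum_congr rfl fun i _ => Finset.sum_congr rfl fun j _ => ?_
    have : single i j (A i j) = A i j • single i j (1 : ℂ) := by simp
    rw [this, map_smul, smul_eq_mul, mul_comm]
  right_inv M := by
    ext i j
    simp [trace_mul_single]

theorem density_apply (ω : Functional ι) (i j : ι) : density ω i j = ω (single j i 1) := rfl

theorem apply_eq_trace (ω : Functional ι) (A : Matrix ι ι ℂ) :
    ω A = (density ω * A).trace := by
  conv_lhs => rw [← density.symm_apply_apply ω]
  rfl

theorem density_vectorState (x : ι → ℂ) : density (vectorState x) = vecMulVec x (star x) := by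
  apply density.symm.injective
  rw [LinearEquiv.symm_apply_apply]
  refine LinearMap.ext fun A => ?_
  rw [apply_eq_trace (density.symm _), LinearEquiv.apply_symm_apply, trace_vecMulVec_mul]
  rfl

theorem density_symm_vecMulVec (x : ι → ℂ) :
    density.symm (vecMulVec x (star x)) = vectorState x := by
  rw [← density_vectorState, LinearEquiv.symm_apply_apply]

theorem trace_density (ω : Functional ι) : (density ω).trace = ω 1 := by
  rw [apply_eq_trace ω, Matrix.mul_one]

theorem apply_vecMulVec (ω : Functional ι) (x : ι → ℂ) :
    ω (vecMulVec x (star x)) = star x ⬝ᵥ density ω *ᵥ x := by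
  rw [apply_eq_trace, trace_mul_comm, trace_vecMulVec_mul]

theorem vectorState_mem_stateSpace {x : ι → ℂ} (hx : star x ⬝ᵥ x = 1) :
    vectorState x ∈ stateSpace ι :=
  ⟨fun A hA => hA.dotProduct_mulVec_nonneg x, by rw [vectorState_apply, one_mulVec, hx]⟩

/-- Linear maps on functionals are determined by their values on states. -/
theorem linearMap_ext_of_states {V : Type*} [AddCommGroup V] [Module ℂ V]
    {T T' : Functional ι →ₗ[ℂ] V} (h : ∀ x : ι → ℂ, star x ⬝ᵥ x = 1 →
      T (vectorState x) = T' (vectorState x)) : T = T' := by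
  have : T ∘ₗ density.symm.toLinearMap = T' ∘ₗ density.symm.toLinearMap := by
    refine linearMap_ext_of_vecMulVec_self fun x => ?_
    simp only [LinearMap.comp_apply, LinearEquiv.coe_coe, density_symm_vecMulVec]
    by_cases hx : x = 0
    · rw [hx, vectorState_zero, map_zero, map_zero]
    · obtain ⟨r, u, -, hu, rfl⟩ := exists_smul_unit hx
      rw [vectorState_smul, map_smul, map_smul, h u hu]
  refine LinearMap.ext fun ω => ?_
  simpa using LinearMap.congr_fun this (density ω)

theorem matrix_ext_of_states {A B : Matrix ι ι ℂ}
    (h : ∀ x : ι → ℂ, star x ⬝ᵥ x = 1 → vectorState x A = vectorState x B) : A = B := by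
  have := linearMap_ext_of_states (T := LinearMap.applyₗ (R := ℂ) (M₂ := ℂ) A)
    (T' := LinearMap.applyₗ (R := ℂ) (M₂ := ℂ) B) h
  ext i j
  simpa [apply_eq_trace (density.symm _), trace_single_mul] using
    LinearMap.congr_fun this (density.symm (single j i 1))

theorem convex_stateSpace : Convex ℝ (stateSpace ι) := by
  intro ω hω τ hτ a b ha hb hab
  refine ⟨fun A hA => ?_, ?_⟩
  · have h1 := hω.1 A hA
    have h2 := hτ.1 A hA
    simp only [LinearMap.add_apply, LinearMap.smul_apply]
    exact add_nonneg (smul_nonneg ha h1) (smul_nonneg hb h2)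
  · simp only [LinearMap.add_apply, LinearMap.smul_apply, hω.2, hτ.2]
    rw [← add_smul, hab, one_smul]

theorem posSemidef_density {ω : Functional ι} (hω : ω ∈ stateSpace ι) :
    (density ω).PosSemidef := by
  have hpos : ∀ x, 0 ≤ ω (vecMulVec x (star x)) := fun x =>
    hω.1 _ (posSemidef_vecMulVec_self_star x)
  refine PosSemidef.of_dotProduct_mulVec_nonneg ?_ fun x => by
    rw [← apply_vecMulVec]
    exact hpos x
  -- Hermiticity: `ω` and its conjugate agree on every `x xᴴ`, where `ω` is real, hence everywhere.
  let ω' : Functional ι :=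
    { toFun := fun A => star (ω Aᴴ)
      map_add' := by simp
      map_smul' := by simp }
  have : ω = ω' := linearMap_ext_of_vecMulVec_self fun x => by
    change _ = star (ω _ᴴ)
    rw [conjTranspose_vecMulVec, star_star]
    exact (IsSelfAdjoint.of_nonneg (hpos x)).star_eq.symm
  ext i j
  rw [conjTranspose_apply, density_apply, density_apply]
  conv_rhs => rw [this]
  change _ = star (ω _ᴴ)
  simp

theorem stateSpace_subset_convexHull : stateSpace ι ⊆
    convexHull ℝ {ω | ∃ x : ι → ℂ, star x ⬝ᵥ x = 1 ∧ ω = vectorState x} := by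
  intro ω hω
  have hpos := posSemidef_density hω
  have hH := hpos.1
  set U := hH.eigenvectorUnitary with hU
  set l := hH.eigenvalues with hl
  have hD : ∀ i j, density ω i j = ∑ k, (l k : ℂ) * (U.1 i k * star (U.1 j k)) := by
    intro i j
    conv_lhs => rw [hH.spectral_theorem]
    rw [Unitary.conjStarAlgAut_apply, Matrix.mul_apply]
    refine Finset.sum_congr rfl fun k _ => ?_
    rw [Matrix.mul_diagonal, star_eq_conjTranspose, conjTranspose_apply]
    simp only [Function.comp_apply, hU, hl]
    change _ * (hH.eigenvalues k : ℂ) * _ = _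
    ring
  have hunit : ∀ k, star (fun i => U.1 i k) ⬝ᵥ (fun i => U.1 i k) = 1 := fun k => by
    have := congrFun (congrFun (mem_unitaryGroup_iff'.1 U.2) k) k
    rw [Matrix.mul_apply, one_apply_eq] at this
    rw [← this]
    rfl
  have hω' : ω = ∑ k, l k • vectorState (fun i => U.1 i k) := by
    apply density.injective
    ext i j
    rw [hD, map_sum, Matrix.sum_apply]
    refine Finset.sum_congr rfl fun k _ => ?_
    have : l k • vectorState (fun i => U.1 i k) =
        (l k : ℂ) • vectorState (fun i => U.1 i k) := rfl
    rw [this, map_smul, density_vectorState]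
    rfl
  have hsum : ∑ k, l k = 1 := by
    have h1 := hω.2
    rw [hω'] at h1
    simp only [LinearMap.sum_apply, LinearMap.smul_apply, vectorState_apply, one_mulVec,
      hunit] at h1
    have : ((∑ k, l k : ℝ) : ℂ) = 1 := by
      rw [← h1]
      simp
    exact_mod_cast this
  rw [hω']
  exact (convex_convexHull ℝ _).sum_mem (fun k _ => hpos.eigenvalues_nonneg k) hsum
    fun k _ => subset_convexHull ℝ _ ⟨_, hunit k, rfl⟩

theorem exists_vectorState_of_mem_extremePoints {ω : Functional ι}
    (h : ω ∈ (stateSpace ι).extremePoints ℝ) :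
    ∃ x : ι → ℂ, star x ⬝ᵥ x = 1 ∧ ω = vectorState x := by
  have heq : stateSpace ι =
      convexHull ℝ {ω | ∃ x : ι → ℂ, star x ⬝ᵥ x = 1 ∧ ω = vectorState x} :=
    stateSpace_subset_convexHull.antisymm (convexHull_min (by
      rintro _ ⟨x, hx, rfl⟩
      exact vectorState_mem_stateSpace hx) convex_stateSpace)
  rw [heq] at h
  have := extremePoints_convexHull_subset h
  exact this

/-- If `ω` occurs in a decomposition of the vector state, positivity forces its density to kill the
orthogonal complement of `x`. A Hermitian matrix with this property and trace one is `x xᴴ`. -/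
theorem vectorState_mem_extremePoints {x : ι → ℂ} (hx : star x ⬝ᵥ x = 1) :
    vectorState x ∈ (stateSpace ι).extremePoints ℝ := by
  refine mem_extremePoints_iff_left.2 ⟨vectorState_mem_stateSpace hx, fun ω hω τ hτ hseg => ?_⟩
  obtain ⟨a, b, ha, hb, -, hab⟩ := hseg
  have hpos := posSemidef_density hω
  have hker : ∀ y : ι → ℂ, star x ⬝ᵥ y = 0 → density ω *ᵥ y = 0 := by
    intro y hy
    rw [← hpos.dotProduct_mulVec_zero_iff, ← apply_vecMulVec]
    have hp := posSemidef_vecMulVec_self_star y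
    have h1 := hω.1 _ hp
    have h2 := hτ.1 _ hp
    have h3 := LinearMap.congr_fun hab (vecMulVec y (star y))
    have h4 : vectorState x (vecMulVec y (star y)) = 0 := by
      rw [apply_vecMulVec, density_vectorState, vecMulVec_mulVec, hy]
      simp
    rw [h4] at h3
    have h5 : a • ω (vecMulVec y (star y)) = 0 :=
      ((add_eq_zero_iff_of_nonneg (smul_nonneg ha.le h1) (smul_nonneg hb.le h2)).1 h3).1
    exact (smul_eq_zero.1 h5).resolve_left ha.ne'
  have hall : ∀ z : ι → ℂ, density ω *ᵥ z = (star x ⬝ᵥ z) • density ω *ᵥ x := by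
    intro z
    have := hker (z - (star x ⬝ᵥ z) • x) (by
      rw [dotProduct_sub, dotProduct_smul, hx]
      simp)
    rwa [mulVec_sub, mulVec_smul, sub_eq_zero] at this
  have hM : density ω = vecMulVec (density ω *ᵥ x) (star x) := by
    refine Matrix.ext_of_mulVec_single fun i => ?_
    rw [hall, vecMulVec_mulVec, op_smul_eq_smul]
  have hM' : density ω = vecMulVec x (star (density ω *ᵥ x)) := by
    conv_lhs => rw [← hpos.1.eq, hM, conjTranspose_vecMulVec, star_star]
  have hc : density ω *ᵥ x = (star (density ω *ᵥ x) ⬝ᵥ x) • x := by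
    conv_lhs => rw [hM']
    rw [vecMulVec_mulVec, op_smul_eq_smul]
  set c := star (density ω *ᵥ x) ⬝ᵥ x with hcdef
  have htr : c = 1 := by
    have h1 := hω.2
    rw [← trace_density, hM', trace_vecMulVec, dotProduct_comm] at h1
    exact h1
  apply density.injective
  rw [density_vectorState, hM, hc, htr, one_smul]

end States

/-! ### Linear extension of affine automorphisms. -/

section Affine

variable {ι : Type*} [Fintype ι] [DecidableEq ι]

theorem exists_convexCombination {Φ : stateSpace ι → stateSpace ι} (h : IsAffineAutomorphism Φ)
    {s : Finset (stateSpace ι)} {w : stateSpace ι → ℝ} (hw : ∀ ω ∈ s, 0 ≤ w ω)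
    (hsum : ∑ ω ∈ s, w ω = 1) :
    ∃ z : stateSpace ι, ∑ ω ∈ s, w ω • (ω : Functional ι) = z ∧
      ∑ ω ∈ s, w ω • (Φ ω : Functional ι) = Φ z := by
  -- The graph of an affine map is convex, which passes from two-point to finite convex
  -- combinations.
  have hconv : Convex ℝ {p : Functional ι × Functional ι |
      ∃ z : stateSpace ι, p.1 = z ∧ p.2 = Φ z} := by
    rintro ⟨_, _⟩ ⟨x, rfl, rfl⟩ ⟨_, _⟩ ⟨y, rfl, rfl⟩ a b ha hb hab
    exact ⟨⟨_, convex_stateSpace x.2 y.2 ha hb hab⟩, rfl,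
      (h.map_convexCombination x y _ a b ha hb hab rfl).symm⟩
  obtain ⟨z, hz, hz'⟩ := hconv.sum_mem (z := fun ω : stateSpace ι =>
    ((ω : Functional ι), (Φ ω : Functional ι))) hw hsum fun ω _ => ⟨ω, rfl, rfl⟩
  refine ⟨z, ?_, ?_⟩
  · rw [← hz, Prod.fst_sum]
    rfl
  · rw [← hz', Prod.snd_sum]
    rfl

/-- Evaluation at `1` shows that the positive and negative coefficients have the same total mass
`r`. Divided by `r`, the relation equates two convex combinations, and `Φ` respects both. -/
theorem sum_smul_map_eq_zero {Φ : stateSpace ι → stateSpace ι} (h : IsAffineAutomorphism Φ)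
    {s : Finset (stateSpace ι)} {c : stateSpace ι → ℝ}
    (h0 : ∑ ω ∈ s, c ω • (ω : Functional ι) = 0) :
    ∑ ω ∈ s, c ω • (Φ ω : Functional ι) = 0 := by
  have hc : ∀ ω, c ω = max (c ω) 0 - max (-c ω) 0 := fun ω =>
    (max_zero_sub_max_neg_zero_eq_self (c ω)).symm
  have hsum : ∑ ω ∈ s, c ω = 0 := by
    have := LinearMap.congr_fun h0 1
    simp only [LinearMap.sum_apply, LinearMap.smul_apply,
      LinearMap.zero_apply] at this
    have h1 : ((∑ ω ∈ s, c ω : ℝ) : ℂ) = 0 := by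
      rw [← this, Complex.ofReal_sum]
      refine Finset.sum_congr rfl fun ω _ => ?_
      rw [ω.2.2]
      simp
    exact_mod_cast h1
  set r := ∑ ω ∈ s, max (c ω) 0 with hr
  have hr' : ∑ ω ∈ s, max (-c ω) 0 = r := by
    rw [Finset.sum_congr rfl fun ω _ => hc ω, Finset.sum_sub_distrib] at hsum
    linarith
  have hr0 : 0 ≤ r := Finset.sum_nonneg fun ω _ => le_max_right _ _
  rcases hr0.eq_or_lt with hr0 | hr0
  · refine Finset.sum_eq_zero fun ω hω => ?_
    have h1 := (Finset.sum_eq_zero_iff_of_nonneg fun ω _ => le_max_right (c ω) 0).1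
      (hr.symm.trans hr0.symm) ω hω
    have h2 := (Finset.sum_eq_zero_iff_of_nonneg fun ω _ => le_max_right (-c ω) 0).1
      (hr'.trans hr0.symm) ω hω
    rw [hc ω, h1, h2, sub_zero, zero_smul]
  · obtain ⟨z, hz, hz'⟩ := exists_convexCombination h (s := s) (w := fun ω => r⁻¹ * max (c ω) 0)
      (fun ω _ => by positivity) (by rw [← Finset.mul_sum, ← hr, inv_mul_cancel₀ hr0.ne'])
    obtain ⟨y, hy, hy'⟩ := exists_convexCombination h (s := s)
      (w := fun ω => r⁻¹ * max (-c ω) 0)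
      (fun ω _ => by positivity) (by rw [← Finset.mul_sum, hr', inv_mul_cancel₀ hr0.ne'])
    have hexp : ∀ f : stateSpace ι → Functional ι, ∑ ω ∈ s, c ω • f ω =
        r • (∑ ω ∈ s, (r⁻¹ * max (c ω) 0) • f ω - ∑ ω ∈ s, (r⁻¹ * max (-c ω) 0) • f ω) := by
      intro f
      rw [← Finset.sum_sub_distrib, Finset.smul_sum]
      refine Finset.sum_congr rfl fun ω _ => ?_
      rw [← sub_smul, smul_smul, ← mul_sub, ← hc, mul_inv_cancel_left₀ hr0.ne']
    rw [hexp, hz, hy, smul_eq_zero, sub_eq_zero, or_iff_right hr0.ne'] at h0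
    rw [hexp, hz', hy', Subtype.ext h0, sub_self, smul_zero]

/-- An affine automorphism of the state space extends to a linear map on functionals. -/
theorem exists_linearMap_extension {Φ : stateSpace ι → stateSpace ι}
    (h : IsAffineAutomorphism Φ) :
    ∃ T : Functional ι →ₗ[ℂ] Functional ι, ∀ ω : stateSpace ι, T ω = Φ ω := by
  let p := Finsupp.linearCombination ℂ (fun ω : stateSpace ι => (ω : Functional ι))
  let q := Finsupp.linearCombination ℂ (fun ω : stateSpace ι => (Φ ω : Functional ι))
  have hp : LinearMap.range p = ⊤ := by
    have : (LinearMap.range p).mkQ = 0 := linearMap_ext_of_states fun x hx => by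
      rw [LinearMap.zero_apply, Submodule.mkQ_apply, Submodule.Quotient.mk_eq_zero]
      exact ⟨Finsupp.single ⟨_, vectorState_mem_stateSpace hx⟩ 1, by
        simp [p, Finsupp.linearCombination_single]⟩
    rw [← Submodule.ker_mkQ (LinearMap.range p), this, LinearMap.ker_zero]
  have hker : ∀ v, p v = 0 → q v = 0 := by
    intro v hv
    have hpos : ∀ (ω : stateSpace ι) (x : ι → ℂ),
        ∃ a : ℝ, (ω : Functional ι) (vecMulVec x (star x)) = a := fun ω x =>
      ⟨_, Complex.eq_re_of_ofReal_le (ω.2.1 _ (posSemidef_vecMulVec_self_star x))⟩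
    have hreal : ∀ f : stateSpace ι → Functional ι, ∑ ω ∈ v.support, v ω • f ω =
        ∑ ω ∈ v.support, (v ω).re • f ω +
          Complex.I • ∑ ω ∈ v.support, (v ω).im • f ω := by
      intro f
      rw [Finset.smul_sum, ← Finset.sum_add_distrib]
      refine Finset.sum_congr rfl fun ω _ => ?_
      have h1 : (v ω).re • f ω = ((v ω).re : ℂ) • f ω := rfl
      have h2 : (v ω).im • f ω = ((v ω).im : ℂ) • f ω := rfl
      rw [h1, h2, smul_smul, ← add_smul, mul_comm, Complex.re_add_im]
    have hsum : ∑ ω ∈ v.support, v ω • (ω : Functional ι) = 0 := hv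
    -- States are real on `x xᴴ`, so a complex relation between them splits into two real ones.
    have hre : ∑ ω ∈ v.support, (v ω).re • (ω : Functional ι) = 0 ∧
        ∑ ω ∈ v.support, (v ω).im • (ω : Functional ι) = 0 := by
      constructor <;> refine linearMap_ext_of_vecMulVec_self fun x => ?_ <;>
        have h1 := LinearMap.congr_fun hsum (vecMulVec x (star x)) <;>
        choose a ha using fun ω => hpos ω x <;>
        simp only [LinearMap.sum_apply, LinearMap.smul_apply, LinearMap.zero_apply, ha,
          smul_eq_mul, Complex.real_smul] at h1 ⊢
      · have h2 := congrArg Complex.re h1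
        simp at h2
        exact_mod_cast h2
      · have h2 := congrArg Complex.im h1
        simp at h2
        exact_mod_cast h2
    change ∑ ω ∈ v.support, v ω • (Φ ω : Functional ι) = 0
    rw [hreal, sum_smul_map_eq_zero h hre.1, sum_smul_map_eq_zero h hre.2, smul_zero, add_zero]
  obtain ⟨g, hg⟩ := p.exists_rightInverse_of_surjective hp
  refine ⟨q ∘ₗ g, fun ω => ?_⟩
  have h1 : q (g ω - Finsupp.single ω 1) = 0 := hker _ (by
    rw [map_sub, ← LinearMap.comp_apply, hg]
    simp [p, Finsupp.linearCombination_single])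
  rw [map_sub, sub_eq_zero] at h1
  rw [LinearMap.comp_apply, h1]
  simp [q, Finsupp.linearCombination_single]

theorem map_mem_extremePoints {Φ Ψ : stateSpace ι → stateSpace ι}
    (h : IsAffineAutomorphism Ψ) (h₁ : ∀ ω, Ψ (Φ ω) = ω) (h₂ : ∀ ω, Φ (Ψ ω) = ω)
    {ω : stateSpace ι} (hω : (ω : Functional ι) ∈ (stateSpace ι).extremePoints ℝ) :
    (Φ ω : Functional ι) ∈ (stateSpace ι).extremePoints ℝ := by
  refine mem_extremePoints_iff_left.2 ⟨(Φ ω).2, fun x hx y hy ⟨a, b, ha, hb, hab, hz⟩ => ?_⟩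
  have h3 := h.map_convexCombination ⟨x, hx⟩ ⟨y, hy⟩ (Φ ω) a b ha.le hb.le hab hz.symm
  rw [h₁] at h3
  have h4 := (mem_extremePoints_iff_left.1 hω).2 _ (Ψ ⟨x, hx⟩).2 _ (Ψ ⟨y, hy⟩).2
    ⟨a, b, ha, hb, hab, h3.symm⟩
  rw [← Subtype.ext h4, h₂]

end Affine

/-! ### Separable vector states and product vectors. -/

section Product

variable {m n : ℕ}

theorem vectorState_prod_mem_S {a : Fin m → ℂ} {b : Fin n → ℂ} (ha : star a ⬝ᵥ a = 1)
    (hb : star b ⬝ᵥ b = 1) : vectorState (fun p : Fin m × Fin n => a p.1 * b p.2) ∈ S m n := by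
  have hprod : ∀ (A : Matrix (Fin m) (Fin m) ℂ) (B : Matrix (Fin n) (Fin n) ℂ),
      vectorState (fun p : Fin m × Fin n => a p.1 * b p.2) (A ⊗ₖ B) =
        vectorState a A * vectorState b B := by
    intro A B
    have hd : vecMulVec (fun p : Fin m × Fin n => a p.1 * b p.2)
        (star fun p : Fin m × Fin n => a p.1 * b p.2) =
          vecMulVec a (star a) ⊗ₖ vecMulVec b (star b) := by
      ext p q
      simp only [vecMulVec_apply, kroneckerMap_apply, Pi.star_apply, star_mul']
      ring
    simp only [apply_eq_trace (vectorState _), density_vectorState, hd]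
    rw [← mul_kronecker_mul, trace_kronecker]
  refine subset_convexHull ℝ _ ⟨vectorState_mem_stateSpace ?_, vectorState a,
    vectorState_mem_stateSpace ha, vectorState b, vectorState_mem_stateSpace hb, hprod⟩
  have := hprod 1 1
  rw [one_kronecker_one] at this
  simpa [vectorState_apply, ha, hb] using this

/-- A vector state is extreme in `K`, hence in the smaller set `S`. Extreme points of a convex hull
lie in the generating set, so it is a product state, and its density factorizes. -/
theorem isRankLEOne_of_vectorState_mem_S {w : Fin m × Fin n → ℂ} (hw : star w ⬝ᵥ w = 1)
    (hS : vectorState w ∈ S m n) : IsRankLEOne (of fun i j => w (i, j)) := by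
  have hsub : S m n ⊆ K m n := convexHull_min (fun ω hω => hω.1) convex_stateSpace
  have hext := inter_extremePoints_subset_extremePoints_of_subset hsub
    ⟨hS, vectorState_mem_extremePoints hw⟩
  obtain ⟨-, σ, -, τ, -, hστ⟩ := extremePoints_convexHull_subset hext
  have hent : ∀ i j k l, star (w (i, j)) * w (k, l) = σ (single i k 1) * τ (single j l 1) := by
    intro i j k l
    rw [← hστ, apply_eq_trace, density_vectorState, trace_vecMulVec_mul]
    rw [single_kronecker_single]
    rw [one_mul, single_mulVec, one_mul]
    exact (dotProduct_single (star w) (w (k, l)) (i, j)).symm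
  by_cases h0 : w = 0
  · intro i k j l
    simp [h0]
  obtain ⟨⟨p, q⟩, hpq⟩ := Function.ne_iff.1 h0
  have hpq' : star (w (p, q)) ≠ 0 := star_ne_zero.2 hpq
  intro i k j l
  simp only [of_apply]
  apply mul_left_cancel₀ (mul_ne_zero hpq' hpq')
  linear_combination star (w (p, q)) * w (k, l) * hent p q i j +
    σ (single p i 1) * τ (single q j 1) * hent p q k l -
    star (w (p, q)) * w (k, j) * hent p q i l -
    σ (single p i 1) * τ (single q l 1) * hent p q k j

end Product

/-! ### From projective to genuine one-parameter unitary groups. -/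

section Lift

variable {ι : Type*} [Fintype ι]

/-- Pairwise commuting matrices have a common eigenvector. -/
theorem exists_common_eigenvector [Nonempty ι] {T : Type*} (f : T → Matrix ι ι ℂ)
    (h : ∀ s t, f s * f t = f t * f s) :
    ∃ v : ι → ℂ, v ≠ 0 ∧ ∀ t, ∃ c : ℂ, f t *ᵥ v = c • v := by
  -- In a nonzero invariant subspace of least dimension, each eigenspace is invariant by
  -- commutation, so it is the whole subspace.
  have hex : ∃ d : ℕ, ∃ W : Submodule ℂ (ι → ℂ), W ≠ ⊥ ∧ (∀ t, ∀ w ∈ W, f t *ᵥ w ∈ W) ∧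
      Module.finrank ℂ W = d := ⟨_, ⊤, top_ne_bot, fun _ _ _ => trivial, rfl⟩
  classical
  obtain ⟨W, hW, hinv, hd⟩ := Nat.find_spec hex
  obtain ⟨v, hv, hv0⟩ := W.ne_bot_iff.1 hW
  refine ⟨v, hv0, fun t => ?_⟩
  let g : Module.End ℂ W := (mulVecLin (f t)).restrict (p := W) (q := W) (hinv t)
  have : Nontrivial W := (Submodule.nontrivial_iff_ne_bot).2 hW
  obtain ⟨c, hc⟩ := Module.End.exists_eigenvalue g
  obtain ⟨⟨u, huW⟩, hu⟩ := hc.exists_hasEigenvector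
  have hue : f t *ᵥ u = c • u := congrArg Subtype.val hu.apply_eq_smul
  have hu0 : u ≠ 0 := fun h0 => hu.2 (Subtype.ext h0)
  let E : Submodule ℂ (ι → ℂ) := W ⊓ LinearMap.ker (mulVecLin (f t) - c • LinearMap.id)
  have hmem : ∀ w, w ∈ E ↔ w ∈ W ∧ f t *ᵥ w = c • w := fun w => by
    simp [E, sub_eq_zero]
  have hE : E ≠ ⊥ := (Submodule.ne_bot_iff _).2 ⟨u, (hmem u).2 ⟨huW, hue⟩, hu0⟩
  have hEinv : ∀ s, ∀ w ∈ E, f s *ᵥ w ∈ E := fun s w hw => by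
    rw [hmem] at hw ⊢
    refine ⟨hinv s w hw.1, ?_⟩
    rw [mulVec_mulVec, h, ← mulVec_mulVec, hw.2, mulVec_smul]
  have hle : Module.finrank ℂ W ≤ Module.finrank ℂ E :=
    hd.le.trans (Nat.find_min' hex ⟨E, hE, hEinv, rfl⟩)
  have hEW : E = W := Submodule.eq_of_le_of_finrank_le inf_le_left hle
  rw [← hEW, hmem] at hv
  exact ⟨c, hv.2⟩

variable [DecidableEq ι]

theorem exists_eq_smul_one_of_forall_commute {A : Matrix ι ι ℂ} (h : ∀ B, A * B = B * A) :
    ∃ c : ℂ, A = c • 1 := by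
  obtain ⟨c, hc⟩ := mem_range_scalar_iff_commute_single'.2
    (fun i j => (h (single i j 1)).symm)
  exact ⟨c, by rw [← hc, smul_one_eq_diagonal, scalar_apply]⟩

/-- Unitaries inducing the same inner automorphism agree up to a scalar. -/
theorem exists_smul_of_conj_eq {U V : Matrix ι ι ℂ} (hU : U ∈ unitaryGroup ι ℂ)
    (hV : V ∈ unitaryGroup ι ℂ) (h : ∀ A, U * A * star U = V * A * star V) :
    ∃ c : ℂ, U = c • V := by
  obtain ⟨c, hc⟩ := exists_eq_smul_one_of_forall_commute (A := star V * U) fun B => by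
    calc star V * U * B = star V * (U * B * star U) * U := by
          simp only [Matrix.mul_assoc, mem_unitaryGroup_iff'.1 hU, Matrix.mul_one]
      _ = (star V * V) * B * (star V * U) := by rw [h]; simp only [Matrix.mul_assoc]
      _ = B * (star V * U) := by rw [mem_unitaryGroup_iff'.1 hV, Matrix.one_mul]
  refine ⟨c, ?_⟩
  calc U = V * (star V * U) := by rw [← Matrix.mul_assoc, mem_unitaryGroup_iff.1 hV, Matrix.one_mul]
    _ = c • V := by rw [hc, Matrix.mul_smul, Matrix.mul_one]

/-- With `N` the dimension and `r = t / N`, one has `U s * U r = z • (U r * U s)`, and determinants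
give `z ^ N = 1`. As `U t` is a multiple of `U r ^ N`, the factor `z ^ N` is all that could obstruct
commutation. -/
theorem commute_of_projective_group [Nonempty ι] {U : ℝ → Matrix ι ι ℂ}
    (hU : ∀ t, U t ∈ unitaryGroup ι ℂ)
    (h : ∀ s t, ∃ c : ℂ, U (s + t) = c • (U s * U t)) (s t : ℝ) : U s * U t = U t * U s := by
  have hdet : ∀ t, (U t).det ≠ 0 := fun t h0 => by
    have := congrArg det (mem_unitaryGroup_iff.1 (hU t))
    rw [det_mul, h0] at this
    simp at this
  have hpow : ∀ r : ℝ, ∀ k : ℕ, ∃ c : ℂ, U ((k + 1 : ℕ) * r) = c • U r ^ (k + 1) := by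
    intro r k
    induction k with
    | zero => exact ⟨1, by simp⟩
    | succ k ih =>
      obtain ⟨c, hc⟩ := ih
      obtain ⟨d, hd⟩ := h ((k + 1 : ℕ) * r) r
      refine ⟨d * c, ?_⟩
      rw [show ((k + 1 + 1 : ℕ) : ℝ) * r = (k + 1 : ℕ) * r + r by push_cast; ring, hd, hc,
        smul_mul, smul_smul, ← pow_succ]
  have hN : Fintype.card ι ≠ 0 := Fintype.card_ne_zero
  obtain ⟨k, hk⟩ := Nat.exists_eq_succ_of_ne_zero hN
  set r := t / (k + 1 : ℕ) with hr
  obtain ⟨c, hc⟩ := hpow r k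
  rw [show ((k + 1 : ℕ) : ℝ) * r = t by rw [hr]; field_simp] at hc
  obtain ⟨a, ha⟩ := h s r
  obtain ⟨b, hb⟩ := h r s
  have hb0 : b ≠ 0 := by
    rintro rfl
    have := hdet (r + s)
    rw [hb, zero_smul, det_zero] at this
    exact this rfl
  have ha0 : a ≠ 0 := by
    rintro rfl
    have := hdet (s + r)
    rw [ha, zero_smul, det_zero] at this
    exact this rfl
  have hz : U s * U r = (a⁻¹ * b) • (U r * U s) := by
    rw [mul_smul, ← hb, add_comm r s, ha, inv_smul_smul₀ ha0]
  set z := a⁻¹ * b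
  have hzp : z ^ (k + 1) = 1 := by
    have := congrArg det hz
    rw [det_smul, det_mul, det_mul, hk, mul_comm (U r).det] at this
    exact mul_right_cancel₀ (mul_ne_zero (hdet s) (hdet r)) (by rw [one_mul]; exact this.symm)
  have hzn : ∀ j : ℕ, U s * U r ^ j = z ^ j • (U r ^ j * U s) := by
    intro j
    induction j with
    | zero => simp
    | succ j ih =>
      rw [pow_succ, ← Matrix.mul_assoc, ih, smul_mul, Matrix.mul_assoc, hz, Matrix.mul_smul,
        smul_smul, ← pow_succ, Matrix.mul_assoc]
  rw [hc, Matrix.mul_smul, smul_mul, hzn, hzp, one_smul]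

/-- A one-parameter group of inner automorphisms is implemented by a one-parameter group of
unitaries, which is continuous if the group of automorphisms is pointwise continuous. -/
theorem exists_isUnitaryOneParameterGroup {k : ℕ} [NeZero k] {U : ℝ → Matrix (Fin k) (Fin k) ℂ}
    (hU : ∀ t, U t ∈ unitaryGroup (Fin k) ℂ)
    (h : ∀ s t A, U (s + t) * A * star (U (s + t)) =
      U s * (U t * A * star (U t)) * star (U s)) :
    ∃ V : ℝ → unitaryGroup (Fin k) ℂ, IsUnitaryOneParameterGroup V ∧
      (∀ t A, (V t : Matrix (Fin k) (Fin k) ℂ) * A * star (V t : Matrix (Fin k) (Fin k) ℂ) =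
        U t * A * star (U t)) ∧
      ((∀ A, Continuous fun t => U t * A * star (U t)) → Continuous V) := by
  have hproj : ∀ s t, ∃ c : ℂ, U (s + t) = c • (U s * U t) := fun s t =>
    exists_smul_of_conj_eq (hU _) (mul_mem (hU s) (hU t)) fun A => by
      rw [h, star_mul]
      simp only [Matrix.mul_assoc]
  obtain ⟨v₀, hv₀, heig₀⟩ := exists_common_eigenvector U (commute_of_projective_group hU hproj)
  obtain ⟨r, v, hr, hv, rfl⟩ := exists_smul_unit hv₀
  have hr0 : (r : ℂ) ≠ 0 := by exact_mod_cast hr.ne'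
  have hv0 : v ≠ 0 := by
    rintro rfl
    simp at hv
  have heig : ∀ t, ∃ c : ℂ, U t *ᵥ v = c • v := fun t => by
    obtain ⟨c, hc⟩ := heig₀ t
    refine ⟨c, smul_right_injective _ hr0 ?_⟩
    simpa only [mulVec_smul, smul_comm c] using hc
  choose μ hμ using heig
  have hμ1 : ∀ t, star (μ t) * μ t = 1 := fun t => by
    have h1 : star (U t *ᵥ v) ⬝ᵥ (U t *ᵥ v) = 1 := by
      rw [star_mulVec, ← dotProduct_mulVec, mulVec_mulVec, ← star_eq_conjTranspose,
        mem_unitaryGroup_iff'.1 (hU t), one_mulVec, hv]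
    rwa [hμ, star_smul, smul_dotProduct, dotProduct_smul, hv, smul_eq_mul, smul_eq_mul,
      mul_one] at h1
  -- Multiplying by the conjugate eigenvalue makes the unitary fix `v`. This leaves no freedom of
  -- phase, so the multipliers become `1`.
  have hconj : ∀ t A, (star (μ t) • U t) * A * star (star (μ t) • U t) =
      U t * A * star (U t) := fun t A => by
    rw [star_smul, star_star, smul_mul, smul_mul, Matrix.mul_smul, smul_smul, hμ1, one_smul]
  have hmem : ∀ t, star (μ t) • U t ∈ unitaryGroup (Fin k) ℂ := fun t => by
    rw [mem_unitaryGroup_iff]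
    have := hconj t 1
    rwa [Matrix.mul_one, Matrix.mul_one, mem_unitaryGroup_iff.1 (hU t)] at this
  let V : ℝ → unitaryGroup (Fin k) ℂ := fun t => ⟨_, hmem t⟩
  have hfix : ∀ t, (V t).1 *ᵥ v = v := fun t => by
    change (star (μ t) • U t) *ᵥ v = v
    rw [smul_mulVec, hμ, smul_smul, hμ1, one_smul]
  have hadd : ∀ s t, V (s + t) = V s * V t := by
    intro s t
    obtain ⟨c, hc⟩ := exists_smul_of_conj_eq (V (s + t)).2 (V s * V t).2 fun A => by
      change (star (μ (s + t)) • U (s + t)) * A * star (star (μ (s + t)) • U (s + t)) =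
        ((star (μ s) • U s) * (star (μ t) • U t)) * A *
          star ((star (μ s) • U s) * (star (μ t) • U t))
      rw [hconj, h, ← hconj s, ← hconj t, star_mul]
      simp only [Matrix.mul_assoc]
    have h1 := hfix (s + t)
    have h2 : (V s * V t).1 *ᵥ v = v := by
      change ((V s).1 * (V t).1) *ᵥ v = v
      rw [← mulVec_mulVec, hfix, hfix]
    rw [hc, smul_mulVec, h2] at h1
    have hc1 : c = 1 := by
      rw [← sub_eq_zero, ← smul_eq_zero_iff_left hv0, sub_smul, h1, one_smul, sub_self]
    apply Subtype.ext
    rw [hc, hc1, one_smul]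
  refine ⟨V, ⟨?_, hadd⟩, hconj, fun hcont => ?_⟩
  · have := hadd 0 0
    rw [add_zero] at this
    exact (mul_eq_left.1 this.symm)
  · refine Continuous.subtype_mk (continuous_matrix fun i j => ?_) hmem
    have hstar : ∀ t, star (V t).1 *ᵥ v = v := fun t => by
      conv_lhs => rw [← hfix t]
      rw [mulVec_mulVec, mem_unitaryGroup_iff'.1 (V t).2, one_mulVec]
    -- Since `star (V t)` fixes the unit vector `v`, column `j` of `V t` is the conjugate of `e_j
    -- vᴴ` applied to `v`; the phase no longer appears.
    have hij : ∀ t, (star (μ t) • U t) i j =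
        ((U t * vecMulVec (Pi.single j 1) (star v) * star (U t)) *ᵥ v) i := fun t => by
      rw [← hconj]
      change (V t).1 i j = (((V t).1 * vecMulVec (Pi.single j 1) (star v) * star (V t).1) *ᵥ v) i
      rw [← mulVec_mulVec, hstar, ← mulVec_mulVec, vecMulVec_mulVec, hv]
      simp
    simp only [hij]
    exact (continuous_apply i).comp (Continuous.matrix_mulVec (hcont _) continuous_const)

end Lift

/-! ### Affine automorphisms on density matrices. -/

section Automorphisms

variable {ι : Type*} [Fintype ι] [DecidableEq ι]

theorem exists_density_map {Φ Ψ : stateSpace ι → stateSpace ι}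
    (hΦ : IsAffineAutomorphism Φ) (hΨ : IsAffineAutomorphism Ψ)
    (h₁ : ∀ ω, Ψ (Φ ω) = ω) (h₂ : ∀ ω, Φ (Ψ ω) = ω) :
    ∃ L : Matrix ι ι ℂ →ₗ[ℂ] Matrix ι ι ℂ, Function.Bijective L ∧
      (∀ ω : stateSpace ι, density (Φ ω : Functional ι) = L (density (ω : Functional ι))) ∧
      (∀ M, (L M).trace = M.trace) ∧
      ∀ x, ∃ u, L (vecMulVec x (star x)) = vecMulVec u (star u) := by
  obtain ⟨T, hT⟩ := exists_linearMap_extension hΦ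
  obtain ⟨R, hR⟩ := exists_linearMap_extension hΨ
  have hRT : R ∘ₗ T = LinearMap.id := linearMap_ext_of_states fun x hx => by
    have := hT ⟨_, vectorState_mem_stateSpace hx⟩
    rw [LinearMap.comp_apply, this, hR, h₁, LinearMap.id_apply]
  have hTR : T ∘ₗ R = LinearMap.id := linearMap_ext_of_states fun x hx => by
    have := hR ⟨_, vectorState_mem_stateSpace hx⟩
    rw [LinearMap.comp_apply, this, hT, h₂, LinearMap.id_apply]
  have hbij : Function.Bijective T := by
    refine Function.bijective_iff_has_inverse.2 ⟨R, fun ω => ?_, fun ω => ?_⟩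
    · exact LinearMap.congr_fun hRT ω
    · exact LinearMap.congr_fun hTR ω
  have hone : ∀ ω, T ω 1 = ω 1 := fun ω => by
    have : LinearMap.applyₗ (R := ℂ) (M₂ := ℂ) (1 : Matrix ι ι ℂ) ∘ₗ T =
        LinearMap.applyₗ (R := ℂ) (M₂ := ℂ) (1 : Matrix ι ι ℂ) :=
      linearMap_ext_of_states fun x hx => by
        have h3 := hT ⟨_, vectorState_mem_stateSpace hx⟩
        simp only [LinearMap.comp_apply, LinearMap.applyₗ_apply_apply]
        rw [h3, (Φ _).2.2, (vectorState_mem_stateSpace hx).2]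
    exact LinearMap.congr_fun this ω
  refine ⟨density.toLinearMap ∘ₗ T ∘ₗ density.symm.toLinearMap,
    density.bijective.comp (hbij.comp density.symm.bijective), fun ω => ?_, fun M => ?_,
    fun x => ?_⟩
  · simp [hT]
  · simp only [LinearMap.comp_apply, LinearEquiv.coe_coe]
    rw [trace_density, hone, ← trace_density, LinearEquiv.apply_symm_apply]
  · simp only [LinearMap.comp_apply, LinearEquiv.coe_coe, density_symm_vecMulVec]
    by_cases hx : x = 0
    · refine ⟨0, ?_⟩
      rw [hx, vectorState_zero, map_zero, map_zero]
      ext i j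
      simp [vecMulVec_apply]
    · obtain ⟨r, u, -, hu, rfl⟩ := exists_smul_unit hx
      have h3 := hT ⟨_, vectorState_mem_stateSpace hu⟩
      obtain ⟨w, -, hw⟩ := exists_vectorState_of_mem_extremePoints
        (map_mem_extremePoints hΨ h₁ h₂ (ω := ⟨_, vectorState_mem_stateSpace hu⟩)
          (vectorState_mem_extremePoints hu))
      refine ⟨(r : ℂ) • w, ?_⟩
      rw [vectorState_smul, map_smul, h3, hw, ← density_vectorState, vectorState_smul]

/-- The square of an affine automorphism of the state space is implemented by a unitary. -/
theorem exists_unitary_of_affine_sq [Nonempty ι] {Φ Ψ : stateSpace ι → stateSpace ι}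
    (hΦ : IsAffineAutomorphism Φ) (hΨ : IsAffineAutomorphism Ψ)
    (h₁ : ∀ ω, Ψ (Φ ω) = ω) (h₂ : ∀ ω, Φ (Ψ ω) = ω) :
    ∃ W ∈ unitaryGroup ι ℂ, ∀ ω : stateSpace ι,
      density (Φ (Φ ω) : Functional ι) = W * density (ω : Functional ι) * Wᴴ := by
  obtain ⟨L, hL, hdens, htr, hvec⟩ := exists_density_map hΦ hΨ h₁ h₂
  obtain ⟨P, Q, hPQ⟩ := exists_sq_eq_mul_mul_transpose hL
    (isRankLEOne_map_of_isRankLEOne_map_self fun x => by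
      obtain ⟨u, hu⟩ := hvec x
      rw [hu]
      exact isRankLEOne_vecMulVec _ _)
  obtain ⟨W, hW, hLW⟩ := exists_unitary_of_map_eq_mul_mul (L := L ∘ₗ L) hPQ
    (fun x => by
      obtain ⟨u, hu⟩ := hvec x
      obtain ⟨w, hw⟩ := hvec u
      exact ⟨w, by rw [LinearMap.comp_apply, hu, hw]⟩)
    (fun M => by rw [LinearMap.comp_apply, htr, htr])
  exact ⟨W, hW, fun ω => by rw [hdens, hdens, ← hLW, LinearMap.comp_apply]⟩

theorem continuous_of_forall_state {X : ℝ → Matrix ι ι ℂ}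
    (h : ∀ ω : stateSpace ι, Continuous fun t => (ω : Functional ι) (X t)) : Continuous X := by
  -- The functionals with continuous orbit form a subspace. It contains the vector states, which
  -- span.
  let N : Submodule ℂ (Functional ι) :=
    { carrier := {ω | Continuous fun t => ω (X t)}
      add_mem' := fun {a b} ha hb => Continuous.add (f := fun t => a (X t)) ha hb
      zero_mem' := continuous_const
      smul_mem' := fun c a ha => (show Continuous fun t => a (X t) from ha).const_smul c }
  have hN : N.mkQ = 0 := linearMap_ext_of_states fun x hx => by
    rw [LinearMap.zero_apply, Submodule.mkQ_apply, Submodule.Quotient.mk_eq_zero]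
    exact h ⟨_, vectorState_mem_stateSpace hx⟩
  have hall : ∀ ω, ω ∈ N := fun ω => by
    rw [← Submodule.Quotient.mk_eq_zero, ← Submodule.mkQ_apply, hN, LinearMap.zero_apply]
  refine continuous_matrix fun i j => ?_
  have := hall (density.symm (single j i 1))
  have h2 : Continuous fun t => (density.symm (single j i 1)) (X t) := this
  simpa [apply_eq_trace (density.symm _), trace_single_mul] using h2

end Automorphisms

/-! ### Unitaries preserving separability. -/

section Tensor

variable {m n : ℕ}

/-- The square of a unitary preserving separability is a tensor product of unitaries. -/
theorem exists_kronecker_of_preserves_separable [NeZero m] [NeZero n]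
    {Φ : K m n → K m n} {W : Matrix (Fin m × Fin n) (Fin m × Fin n) ℂ}
    (hW : W ∈ unitaryGroup (Fin m × Fin n) ℂ)
    (hΦ : ∀ ω : K m n, density (Φ ω : Functional (Fin m × Fin n)) =
      W * density (ω : Functional (Fin m × Fin n)) * Wᴴ)
    (hsep : ∀ ω : K m n, (ω : Functional (Fin m × Fin n)) ∈ S m n →
      (Φ ω : Functional (Fin m × Fin n)) ∈ S m n) :
    ∃ U ∈ unitaryGroup (Fin m) ℂ, ∃ V ∈ unitaryGroup (Fin n) ℂ, W * W = U ⊗ₖ V := by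
  -- Under this identification product vectors are the rank-one matrices, and `P ⊗ₖ Q` acts as `M ↦
  -- P * M * Qᵀ`.
  let c : Matrix (Fin m) (Fin n) ℂ ≃ₗ[ℂ] (Fin m × Fin n → ℂ) :=
    (LinearEquiv.curry ℂ ℂ (Fin m) (Fin n)).symm
  let L : Matrix (Fin m) (Fin n) ℂ →ₗ[ℂ] Matrix (Fin m) (Fin n) ℂ :=
    c.symm.toLinearMap ∘ₗ mulVecLin W ∘ₗ c.toLinearMap
  have hLapply : ∀ M i j, L M i j = (W *ᵥ c M) (i, j) := fun M i j => rfl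
  have hcL : ∀ M, c (L M) = W *ᵥ c M := fun M => rfl
  have hWbij : Function.Bijective (mulVecLin W) := by
    refine Function.bijective_iff_has_inverse.2 ⟨mulVecLin (star W), fun x => ?_, fun x => ?_⟩
    · simp only [mulVecLin_apply]
      rw [mulVec_mulVec, mem_unitaryGroup_iff'.1 hW, one_mulVec]
    · simp only [mulVecLin_apply]
      rw [mulVec_mulVec, mem_unitaryGroup_iff.1 hW, one_mulVec]
  have hLbij : Function.Bijective L :=
    c.symm.bijective.comp (hWbij.comp c.bijective)
  have hunit : ∀ (a : Fin m → ℂ) (b : Fin n → ℂ), star a ⬝ᵥ a = 1 → star b ⬝ᵥ b = 1 →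
      IsRankLEOne (L (vecMulVec a b)) := by
    intro a b ha hb
    have hS := vectorState_prod_mem_S ha hb
    set x : Fin m × Fin n → ℂ := fun p => a p.1 * b p.2 with hx
    have hK : vectorState x ∈ K m n :=
      (convexHull_min (fun ω hω => hω.1) convex_stateSpace : S m n ⊆ K m n) hS
    have hx1 : star x ⬝ᵥ x = 1 := by
      rw [← hK.2, vectorState_apply, one_mulVec]
    have h1 := hsep ⟨_, hK⟩ hS
    have h2 : (Φ ⟨_, hK⟩ : Functional (Fin m × Fin n)) = vectorState (W *ᵥ x) := by
      apply density.injective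
      rw [hΦ, density_vectorState, density_vectorState, mul_vecMulVec_self_mul]
    rw [h2] at h1
    refine isRankLEOne_of_vectorState_mem_S (w := W *ᵥ x) ?_ h1
    rw [star_mulVec, ← dotProduct_mulVec, mulVec_mulVec, ← star_eq_conjTranspose,
      mem_unitaryGroup_iff'.1 hW, one_mulVec, hx1]
  have hrank : ∀ a b, IsRankLEOne (L (vecMulVec a b)) := by
    intro a b
    by_cases ha : a = 0
    · have h0 : L (vecMulVec a b) = 0 := by rw [ha, zero_vecMulVec, map_zero]
      intro i k j l
      simp [h0]
    by_cases hb : b = 0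
    · have h0 : vecMulVec a b = 0 := by
        ext
        simp [vecMulVec_apply, hb]
      intro i k j l
      simp [h0]
    obtain ⟨r, a, -, ha', rfl⟩ := exists_smul_unit ha
    obtain ⟨s, b, -, hb', rfl⟩ := exists_smul_unit hb
    intro i k j l
    simp only [smul_vecMulVec, vecMulVec_smul, map_smul, Matrix.smul_apply, smul_eq_mul]
    linear_combination (r : ℂ) ^ 2 * (s : ℂ) ^ 2 * hunit a b ha' hb' i k j l
  obtain ⟨P, Q, hPQ⟩ := exists_sq_eq_mul_mul_transpose hLbij hrank
  have hWW : W * W = P ⊗ₖ Q := by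
    ext ⟨i, j⟩ ⟨k, l⟩
    have h1 := congrFun (congrFun (hPQ (vecMulVec (Pi.single k 1) (Pi.single l 1))) i) j
    rw [hLapply, hcL, mulVec_mulVec] at h1
    have h2 : c (vecMulVec (Pi.single k 1) (Pi.single l 1)) = Pi.single (k, l) 1 := by
      ext ⟨p, q⟩
      change vecMulVec (Pi.single k 1) (Pi.single l 1) p q = _
      rw [← single_eq_vecMulVec, single_apply, Pi.single_apply]
      simp [Prod.ext_iff, eq_comm]
    rw [h2, mul_vecMulVec, vecMulVec_mul, vecMul_transpose, vecMulVec_apply] at h1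
    simpa using h1
  obtain ⟨U, hU, V, hV, hUV⟩ := exists_unitary_kronecker_eq (hWW ▸ mul_mem hW hW)
  exact ⟨U, hU, V, hV, hWW.trans hUV⟩

theorem kronecker_one_injective [NeZero n] {A B : Matrix (Fin m) (Fin m) ℂ}
    (h : A ⊗ₖ (1 : Matrix (Fin n) (Fin n) ℂ) = B ⊗ₖ 1) : A = B := by
  ext i j
  simpa using congrFun (congrFun h (i, 0)) (j, 0)

theorem one_kronecker_injective [NeZero m] {A B : Matrix (Fin n) (Fin n) ℂ}
    (h : (1 : Matrix (Fin m) (Fin m) ℂ) ⊗ₖ A = 1 ⊗ₖ B) : A = B := by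
  ext i j
  simpa using congrFun (congrFun h (0, i)) (0, j)

theorem isEmpty_K (h : m = 0 ∨ n = 0) : IsEmpty (K m n) := by
  refine ⟨fun ω => ?_⟩
  have hE : IsEmpty (Fin m × Fin n) := by
    rcases h with rfl | rfl <;> infer_instance
  have h1 := ω.2.2
  rw [Subsingleton.elim (1 : Matrix (Fin m × Fin n) (Fin m × Fin n) ℂ) 0, map_zero] at h1
  exact zero_ne_one h1

theorem exists_unitaries_of_group [NeZero m] [NeZero n] {Φ : ℝ → K m n → K m n}
    (hgroup : IsOneParameterGroup Φ) (haffine : ∀ t : ℝ, IsAffineAutomorphism (Φ t))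
    (hent : ∀ t : ℝ, PreservesEntanglement (Φ t)) (t : ℝ) :
    ∃ U ∈ unitaryGroup (Fin m) ℂ, ∃ V ∈ unitaryGroup (Fin n) ℂ,
      ∀ (ω : K m n) (A : Matrix (Fin m × Fin n) (Fin m × Fin n) ℂ),
        (Φ t ω : Functional (Fin m × Fin n)) A =
          (ω : Functional (Fin m × Fin n)) ((U ⊗ₖ V) * A * (star U ⊗ₖ star V)) := by
  have hadd : ∀ s t ω, Φ (s + t) ω = Φ s (Φ t ω) := fun s t ω => by rw [hgroup.add]; rfl
  have hinv : ∀ t ω, Φ (-t) (Φ t ω) = ω := fun t ω => by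
    rw [← hadd, neg_add_cancel, hgroup.zero]; rfl
  have hinv' : ∀ t ω, Φ t (Φ (-t) ω) = ω := fun t ω => by
    rw [← hadd, add_neg_cancel, hgroup.zero]; rfl
  have hsep : ∀ t, ∀ ω : K m n, (ω : Functional (Fin m × Fin n)) ∈ S m n →
      (Φ t ω : Functional (Fin m × Fin n)) ∈ S m n := fun t ω hω => by
    by_contra hc
    have := hent (-t) (Φ t ω) hc
    rw [hinv] at this
    exact this hω
  -- One squaring, from `t / 4` to `t / 2`, removes the antiunitary case; the next, from `t / 2` to
  -- `t`, removes the flip.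
  obtain ⟨W, hW, hWd⟩ := exists_unitary_of_affine_sq (haffine (t / 4)) (haffine (-(t / 4)))
    (hinv _) (hinv' _)
  have hhalf : ∀ ω, Φ (t / 4) (Φ (t / 4) ω) = Φ (t / 2) ω := fun ω => by
    rw [← hadd]
    congr 1
    ring
  simp only [hhalf] at hWd
  obtain ⟨U, hU, V, hV, hUV⟩ := exists_kronecker_of_preserves_separable hW hWd (hsep _)
  -- Densities transform by `U ⊗ₖ V`, so observables transform by its adjoint.
  refine ⟨star U, Unitary.star_mem hU, star V, Unitary.star_mem hV, fun ω A => ?_⟩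
  have ht : Φ t ω = Φ (t / 2) (Φ (t / 2) ω) := by rw [← hadd, add_halves]
  have hd : density (Φ t ω : Functional (Fin m × Fin n)) =
      (U ⊗ₖ V) * density (ω : Functional (Fin m × Fin n)) * (U ⊗ₖ V)ᴴ := by
    rw [ht, hWd, hWd, ← hUV, conjTranspose_mul]
    simp only [Matrix.mul_assoc]
  rw [apply_eq_trace, hd, apply_eq_trace (ω : Functional (Fin m × Fin n)), star_star, star_star,
    star_eq_conjTranspose, star_eq_conjTranspose, ← conjTranspose_kronecker]
  rw [Matrix.mul_assoc, Matrix.mul_assoc, trace_mul_comm]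
  simp only [Matrix.mul_assoc]

end Tensor

end SepStates

/-! ### Assembly of the two unitary groups. -/

theorem corollary5p9 (m n : ℕ) (Φ : ℝ → SepStates.K m n → SepStates.K m n)
    (hgroup : SepStates.IsOneParameterGroup Φ)
    (haffine : ∀ t : ℝ, SepStates.IsAffineAutomorphism (Φ t))
    (hent : ∀ t : ℝ, SepStates.PreservesEntanglement (Φ t)) :
    ∃ (U : ℝ → Matrix.unitaryGroup (Fin m) ℂ) (V : ℝ → Matrix.unitaryGroup (Fin n) ℂ),
      SepStates.IsUnitaryOneParameterGroup U ∧ SepStates.IsUnitaryOneParameterGroup V ∧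
      (SepStates.IsPointwiseContinuous Φ → Continuous U ∧ Continuous V) ∧
      ∀ (t : ℝ) (ω : SepStates.K m n) (A : Matrix (Fin m × Fin n) (Fin m × Fin n) ℂ),
        (Φ t ω : SepStates.Functional (Fin m × Fin n)) A =
          (ω : SepStates.Functional (Fin m × Fin n))
            (((U t : Matrix (Fin m) (Fin m) ℂ) ⊗ₖ (V t : Matrix (Fin n) (Fin n) ℂ)) * A *
              ((star (U t : Matrix (Fin m) (Fin m) ℂ)) ⊗ₖ
                (star (V t : Matrix (Fin n) (Fin n) ℂ)))) := by
  by_cases h0 : m = 0 ∨ n = 0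
  · have := SepStates.isEmpty_K h0
    exact ⟨fun _ => 1, fun _ => 1, ⟨rfl, fun _ _ => (mul_one _).symm⟩,
      ⟨rfl, fun _ _ => (mul_one _).symm⟩, fun _ => ⟨continuous_const, continuous_const⟩,
      fun _ ω => isEmptyElim ω⟩
  push Not at h0
  have : NeZero m := ⟨h0.1⟩
  have : NeZero n := ⟨h0.2⟩
  choose U hU V hV hUV using SepStates.exists_unitaries_of_group hgroup haffine hent
  have hmul : ∀ t (A : Matrix (Fin m) (Fin m) ℂ) (B : Matrix (Fin n) (Fin n) ℂ),
      (U t ⊗ₖ V t) * (A ⊗ₖ B) * (star (U t) ⊗ₖ star (V t)) =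
        (U t * A * star (U t)) ⊗ₖ (V t * B * star (V t)) := fun t A B => by
    rw [← Matrix.mul_kronecker_mul, ← Matrix.mul_kronecker_mul]
  have hU1 : ∀ t, U t * 1 * star (U t) = 1 := fun t => by
    rw [Matrix.mul_one, Matrix.mem_unitaryGroup_iff.1 (hU t)]
  have hV1 : ∀ t, V t * 1 * star (V t) = 1 := fun t => by
    rw [Matrix.mul_one, Matrix.mem_unitaryGroup_iff.1 (hV t)]
  have hcomp : ∀ s t (A : Matrix (Fin m) (Fin m) ℂ) (B : Matrix (Fin n) (Fin n) ℂ),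
      (U (s + t) * A * star (U (s + t))) ⊗ₖ (V (s + t) * B * star (V (s + t))) =
        (U s * (U t * A * star (U t)) * star (U s)) ⊗ₖ
          (V s * (V t * B * star (V t)) * star (V s)) := by
    intro s t A B
    refine SepStates.matrix_ext_of_states fun x hx => ?_
    have hK : SepStates.vectorState x ∈ SepStates.K m n :=
      SepStates.vectorState_mem_stateSpace hx
    have h1 := hUV (s + t) ⟨_, hK⟩ (A ⊗ₖ B)
    -- Passing to observables reverses composition, so the sum is first written as `t + s`.
    rw [add_comm s t, hgroup.add, Function.comp_apply, hUV, hmul, hUV, hmul, add_comm t s,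
      hmul] at h1
    exact h1.symm
  obtain ⟨U', hU'g, hU', hU'c⟩ := SepStates.exists_isUnitaryOneParameterGroup hU fun s t A => by
    refine SepStates.kronecker_one_injective (n := n) ?_
    have := hcomp s t A 1
    rwa [hV1, hV1, hV1] at this
  obtain ⟨V', hV'g, hV', hV'c⟩ := SepStates.exists_isUnitaryOneParameterGroup hV fun s t B => by
    refine SepStates.one_kronecker_injective (m := m) ?_
    have := hcomp s t 1 B
    rwa [hU1, hU1, hU1] at this
  refine ⟨U', V', hU'g, hV'g, fun hc => ⟨hU'c fun A => ?_, hV'c fun B => ?_⟩, fun t ω A => ?_⟩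
  · have h1 : Continuous fun t =>
        (U t * A * star (U t)) ⊗ₖ (1 : Matrix (Fin n) (Fin n) ℂ) :=
      SepStates.continuous_of_forall_state fun ω => by
        have := hc ω (A ⊗ₖ 1)
        simpa only [hUV, hmul, hV1] using this
    refine continuous_matrix fun i j => ?_
    simpa using h1.matrix_elem (i, (0 : Fin n)) (j, 0)
  · have h1 : Continuous fun t =>
        (1 : Matrix (Fin m) (Fin m) ℂ) ⊗ₖ (V t * B * star (V t)) :=
      SepStates.continuous_of_forall_state fun ω => by
        have := hc ω (1 ⊗ₖ B)
        simpa only [hUV, hmul, hU1] using this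
    refine continuous_matrix fun i j => ?_
    simpa using h1.matrix_elem ((0 : Fin m), i) (0, j)
  · rw [hUV]
    congr 1
    -- The new unitaries induce the same conjugations on each factor; matrix units are Kronecker
    -- products, so this suffices.
    induction A using Matrix.induction_on' with
    | h_zero => simp
    | h_add A B hA hB => simp only [Matrix.mul_add, Matrix.add_mul, hA, hB]
    | h_std_basis p q c =>
      have hs : Matrix.single p q c = Matrix.single p.1 q.1 c ⊗ₖ Matrix.single p.2 q.2 1 := by
        rw [Matrix.single_kronecker_single, mul_one]
      rw [hs, hmul, ← Matrix.mul_kronecker_mul, ← Matrix.mul_kronecker_mul, hU', hV']
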